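/- Let $U\in C^\infty(\mathbb R;\mathbb R)$ and let $U_-,U_+\in\mathbb R$. Where it occurs, $U''/U$ is understood as extended by continuity at the (unique) zero of $U$. Assume: (H1) $U'(y)>0$ for all $y\in\mathbb R$, $\lim_{y\to\pm\infty}U(y)=U_\pm$, $U''/U\in L^\infty(\mathbb R)$, and $(U''/U)(y)<0$ for all $y\in\mathbb R$. (H2) With $m:=(-U''/U)^{1/2}$: for every integer $k\ge 0$ there is $C_k>0$ with $|m^{(k)}|\le C_k m$ on $\mathbb R$; $m(y)\to0$ as $|y|\to\infty$; $m\in L^2(\mathbb R)$; and $U''/(U-U_+)$ and $U''/(U-U_-)$ both belong to $L^\infty(\mathbb R)\cap L^2(\mathbb R)$. (H3) The infimum $\lambda_0$ of the spectrum of the operator $\mathcal L=-\partial_y^2-m^2$ on $L^2(\mathbb R;\mathbb C)$, with domain $H^2(\mathbb R)$, satisfies $\lambda_0>-1$. For $\alpha\in\mathbb Z\setminus\{0\}$ let $\Delta_\alpha=\partial_y^2-\alpha^2$, let $S=(1+m\Delta_\alpha^{-1}m)^{1/2}$ (nonnegative square root of a bounded operator on $L^2(\mathbb R;\mathbb C)$),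 and let $H=H_\alpha=S\,U\,S$, where $m$ and $U$ act by multiplication. Let $A=i\partial_y$ with domain $H^1(\mathbb R)$. Let $F:\,]U_-,U_+[\,\to\mathbb R$, $F(u)=U'(U^{-1}(u))$, so that $F(U(y))=U'(y)$. Then, for every $\alpha\in\mathbb Z\setminus\{0\}$, $H_\alpha$ maps $H^1(\mathbb R)$ into itself and the commutator $[H_\alpha,A]=H_\alpha A-AH_\alpha$, defined on $H^1(\mathbb R)$, extends to a bounded operator on $L^2(\mathbb R;\mathbb C)$, still denoted $[H_\alpha,A]$. Moreover, for every nonempty compact interval $I\subset\,]U_-,U_+[$, the minimum $\theta_I=\min_I F$ exists and is positive, and there is a compact operator $K$ on $L^2(\mathbb R;\mathbb C)$, depending neither on $\alpha$ nor on $g$, such that for every $\alpha\in\mathbb Z\setminus\{0\}$ and every nonnegative $g\in C^\infty_c(]U_-,U_+[)$ with support contained in $I$, $$ g(H_\alpha)\,i[H_\alpha,A]\,g(H_\alpha)\;\ge\;\theta_I\,g(H_\alpha)^2+g(H_\alpha)\,K\,g(H_\alpha) $$ in the sense of symmetric operators, where $g(H_\alpha)$ is defined by the functional calculus of the bounded self-adjoint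 operator $H_\alpha$. -/

import Mathlib

open MeasureTheory Filter Topology Set
open scoped ENNReal ContDiff SchwartzMap FourierTransform LineDeriv

noncomputable section

namespace ShearFlow

/-! ### Functional calculus in a Hilbert space -/

section

variable {E : Type} [NormedAddCommGroup E] [InnerProductSpace ℂ E] [CompleteSpace E]

/-- The nonnegative square root of a nonnegative bounded operator. -/
def opSqrt (B : E →L[ℂ] E) : E →L[ℂ] E := CFC.sqrt B

/-- `g(B)`, the continuous functional calculus of a bounded self-adjoint operator `B`. -/
def funCalc (g : ℝ → ℝ) (B : E →L[ℂ] E) : E →L[ℂ] E := cfc g B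

end

/-! ### The Hilbert space and operators on it -/

/-- The complex Hilbert space `L²(ℝ; ℂ)`. -/
abbrev L2 : Type := Lp ℂ 2 (volume : Measure ℝ)

open Classical in
/-- The bounded operator of multiplication by a function `φ ∈ L^∞(ℝ; ℂ)` on `L²(ℝ; ℂ)`
(set to `0` if `φ` is not in `L^∞`). -/
def mulOp (φ : ℝ → ℂ) : L2 →L[ℂ] L2 :=
  if h : MemLp φ ∞ (volume : Measure ℝ) then
    (ContinuousLinearMap.mul ℂ ℂ).holderL volume ∞ 2 2 (h.toLp φ)
  else 0

theorem coeFn_mulOp {φ : ℝ → ℂ} (h : MemLp φ ∞ (volume : Measure ℝ)) (u : L2) :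
    mulOp φ u =ᵐ[volume] fun y => φ y * u y := by
  simp only [mulOp, dif_pos h, ContinuousLinearMap.holderL_apply_apply]
  filter_upwards [(ContinuousLinearMap.mul ℂ ℂ).coeFn_holder (r := 2) (h.toLp φ) u,
    h.coeFn_toLp] with y h1 h2
  rw [h1, h2]; rfl

/-- The bounded operator `𝓕⁻¹ p(ξ) 𝓕` on `L²(ℝ; ℂ)`, where
`𝓕 u (ξ) = ∫ exp (-2 π i y ξ) u(y) dy`. -/
def fourierMultiplier (p : ℝ → ℂ) : L2 →L[ℂ] L2 :=
  ((Lp.fourierTransformₗᵢ ℝ ℂ).symm.toContinuousLinearEquiv : L2 →L[ℂ] L2) ∘L mulOp p ∘L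
    ((Lp.fourierTransformₗᵢ ℝ ℂ).toContinuousLinearEquiv : L2 →L[ℂ] L2)

/-- `Δ_α⁻¹`, the inverse of `Δ_α = ∂_y² - α²` on `L²(ℝ; ℂ)`. -/
def laplaceInv (α : ℤ) : L2 →L[ℂ] L2 :=
  fourierMultiplier fun ξ => ((-((2 * Real.pi * ξ) ^ 2 + (α : ℝ) ^ 2)⁻¹ : ℝ) : ℂ)

/-- The embedding of `L²(ℝ; ℂ)` into the tempered distributions. -/
def toDistr : L2 →ₗ[ℂ] 𝓢'(ℝ, ℂ) :=
  (Lp.toTemperedDistributionCLM ℂ (volume : Measure ℝ) 2).toLinearMap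

theorem toDistr_injective : Function.Injective toDistr :=
  LinearMap.ker_eq_bot.1 Lp.ker_toTemperedDistributionCLM_eq_bot

/-- The maximal realization in `L²` of a linear operator `T` on tempered distributions: its domain
consists of the `u ∈ L²` such that `T u` is (represented by) an element of `L²`. -/
def l2Realization (T : 𝓢'(ℝ, ℂ) →L[ℂ] 𝓢'(ℝ, ℂ)) : L2 →ₗ.[ℂ] L2 where
  domain := (LinearMap.range toDistr).comap (T.toLinearMap ∘ₗ toDistr)
  toFun := (LinearEquiv.ofInjective toDistr toDistr_injective).symm.toLinearMap ∘ₗ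
    (T.toLinearMap ∘ₗ toDistr).submoduleComap (LinearMap.range toDistr)

theorem mem_l2Realization_domain (T : 𝓢'(ℝ, ℂ) →L[ℂ] 𝓢'(ℝ, ℂ)) (u : L2) :
    u ∈ (l2Realization T).domain ↔ ∃ v : L2, toDistr v = T (toDistr u) :=
  Iff.rfl

theorem l2Realization_spec (T : 𝓢'(ℝ, ℂ) →L[ℂ] 𝓢'(ℝ, ℂ)) (u : (l2Realization T).domain) :
    toDistr (l2Realization T u) = T (toDistr u) :=
  congrArg Subtype.val ((LinearEquiv.ofInjective toDistr toDistr_injective).apply_symm_apply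
    ((T.toLinearMap ∘ₗ toDistr).submoduleComap (LinearMap.range toDistr) u))

/-- The weak derivative `∂_y` on `L²(ℝ; ℂ)`, with domain `H¹(ℝ)`. -/
def weakDeriv : L2 →ₗ.[ℂ] L2 := l2Realization (TemperedDistribution.derivCLM ℂ)

/-- The weak second derivative `∂_y²` on `L²(ℝ; ℂ)`, with domain `H²(ℝ)`. -/
def weakDeriv₂ : L2 →ₗ.[ℂ] L2 :=
  l2Realization (TemperedDistribution.derivCLM ℂ ∘L TemperedDistribution.derivCLM ℂ)

/-- The conjugate operator `A = i ∂_y`, with domain `H¹(ℝ)`. -/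
def conjOp : L2 →ₗ.[ℂ] L2 := Complex.I • weakDeriv

/-- `C` is the bounded operator `[B, T] = B T - T B`, where `B` is bounded and `T` is an unbounded
operator: `B` maps the domain of `T` to itself and the identity holds on that domain (such a `C`
is unique if `T` is densely defined). -/
def IsCommutator (B : L2 →L[ℂ] L2) (T : L2 →ₗ.[ℂ] L2) (C : L2 →L[ℂ] L2) : Prop :=
  ∀ u : T.domain, ∃ h : B u ∈ T.domain, C u = B (T u) - T ⟨B u, h⟩

/-- The resolvent set of an unbounded operator `T`: the `z` such that `z - T` is a bijection from
the domain of `T` onto `L²` with a bounded inverse `R`. -/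
def resolventSet (T : L2 →ₗ.[ℂ] L2) : Set ℂ :=
  {z | ∃ R : L2 →L[ℂ] L2,
    (∀ f : L2, ∃ h : R f ∈ T.domain, z • R f - T ⟨R f, h⟩ = f) ∧
    ∀ u : T.domain, R (z • (u : L2) - T u) = u}

/-- The spectrum of an unbounded operator. -/
def unboundedSpectrum (T : L2 →ₗ.[ℂ] L2) : Set ℂ := (resolventSet T)ᶜ

/-! ### The shear profile -/

/-- The function `U'' / U`. At a zero of `U` (where the hypotheses on `U` force `U'' = 0` and
`U' > 0`) the quotient stands for its continuous extension, whose value is `U''' / U'`. -/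
def curvatureRatio (U : ℝ → ℝ) (y : ℝ) : ℝ :=
  if U y = 0 then iteratedDeriv 3 U y / deriv U y else iteratedDeriv 2 U y / U y

/-- `m = (- U'' / U)^{1/2}`. -/
def m (U : ℝ → ℝ) (y : ℝ) : ℝ := √(-curvatureRatio U y)

/-- Hypothesis (H1) on the smooth profile `U`, with limits `Um` at `-∞` and `Up` at `+∞`. -/
structure H1 (U : ℝ → ℝ) (Um Up : ℝ) : Prop where
  smooth : ContDiff ℝ ∞ U
  deriv_pos : ∀ y, 0 < deriv U y
  tendsto_atTop : Tendsto U atTop (𝓝 Up)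
  tendsto_atBot : Tendsto U atBot (𝓝 Um)
  ratio_bounded : MemLp (curvatureRatio U) ∞ volume
  ratio_neg : ∀ y, curvatureRatio U y < 0

/-- Hypothesis (H2) on the profile `U`. -/
structure H2 (U : ℝ → ℝ) (Um Up : ℝ) : Prop where
  deriv_bound : ∀ k : ℕ, ∃ C : ℝ, 0 < C ∧ ∀ y, |iteratedDeriv k (m U) y| ≤ C * m U y
  tendsto_zero : Tendsto (m U) (cocompact ℝ) (𝓝 0)
  memLp_two : MemLp (m U) 2 volume
  bounded_top : MemLp (fun y => iteratedDeriv 2 U y / (U y - Up)) ∞ volume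
  memLp_top : MemLp (fun y => iteratedDeriv 2 U y / (U y - Up)) 2 volume
  bounded_bot : MemLp (fun y => iteratedDeriv 2 U y / (U y - Um)) ∞ volume
  memLp_bot : MemLp (fun y => iteratedDeriv 2 U y / (U y - Um)) 2 volume

/-- The Schrödinger operator `ℒ = - ∂_y² - m²` with domain `H²(ℝ)`. -/
def schrodinger (U : ℝ → ℝ) : L2 →ₗ.[ℂ] L2 :=
  (-(mulOp fun y => ((m U y ^ 2 : ℝ) : ℂ)) : L2 →L[ℂ] L2).toLinearMap +ᵥ (-weakDeriv₂)

/-- Hypothesis (H3): the infimum `l₀` of the spectrum of `ℒ` satisfies `l₀ > -1`. -/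
def H3 (U : ℝ → ℝ) : Prop :=
  ∃ l₀ : ℝ, IsGLB {r : ℝ | (r : ℂ) ∈ unboundedSpectrum (schrodinger U)} l₀ ∧ -1 < l₀

/-- `Σ = 1 + m Δ_α⁻¹ m`. -/
def Sig (U : ℝ → ℝ) (α : ℤ) : L2 →L[ℂ] L2 :=
  1 + mulOp (fun y => (m U y : ℂ)) * laplaceInv α * mulOp (fun y => (m U y : ℂ))

/-- `S = Σ^{1/2}`, the nonnegative square root. -/
def S (U : ℝ → ℝ) (α : ℤ) : L2 →L[ℂ] L2 := opSqrt (Sig U α)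

/-- `H = S U S`. -/
def H (U : ℝ → ℝ) (α : ℤ) : L2 →L[ℂ] L2 :=
  S U α * mulOp (fun y => (U y : ℂ)) * S U α

/-- `F = U' ∘ U⁻¹`, so that `F (U y) = U' y`. -/
def F (U : ℝ → ℝ) (u : ℝ) : ℝ := deriv U (Function.invFun U u)

theorem F_apply {U : ℝ → ℝ} (hU : ∀ y, 0 < deriv U y) (y : ℝ) : F U (U y) = deriv U y := by
  rw [F, Function.leftInverse_invFun (strictMono_of_deriv_pos hU).injective y]

end ShearFlow

end

/-!
# A Mourre estimate for a linearized shear flow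

Write `∂` for the weak derivative and `T_s = m (s - ∂²)⁻¹ m` for `s > 0`. Then `S² = 1 - T` with
`T = T_{α²}`, and `i [H, A] = [∂, H]` with `H = S U S`.

*The operator `T_s` is a strict contraction for `s ≥ 1`.* Since `T_s` decreases with `s`, only `T_1`
matters. By the Birman–Schwinger principle (`isUnit_one_sub_birmanSchwinger`) the hypothesis on the
spectrum of `-∂² - m²` says that `1` is not in the spectrum of `T_s`, so `‖T_s‖ ≠ 1`, for `s ≥ 1`;
as `‖T_s‖` is continuous in `s` and tends to `0`, it stays below `1`
(`norm_birmanSchwinger_one_lt`). Hence `S` is given by the norm convergent binomial series in `T`.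

*Compactness with decay.* As `m` and `m'` are square integrable, `T_s` and `[∂, T_s]` are compact
(products of functions of position and of frequency are Hilbert–Schmidt), and both are `O(1/s)` in
norm. Differentiating the binomial series term by term (`HasComm.exists_opSqrt`), the same holds for
`S - 1` and `[∂, S]`. Therefore `H - U` and `[∂, H] - U'` are compact, self-adjoint and `O(α⁻²)`
(`exists_hasComm_H`). The function `m` need not be differentiable at the zero of `U`; the product
rule in `H¹` (`IsDeriv.mulOp`) allows for one exceptional point.

*The estimate.* Let `f ∈ C_c^∞(]U₋, U₊[)` agree with `F` on `I`, with `f ≤ F`. Then `U' ≥ f(U)`, and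
`f(U) - f(H)` is compact and `O(α⁻²)`, because `f` is operator Lipschitz
(`exists_norm_funCalc_sub_le`, by Fourier inversion and Duhamel's formula). So `[∂, H] ≥ f(H) + Z_α`
with `Z_α` compact and `O(α⁻²)`. A compact operator independent of `α` that lies below all `Z_α` is
`K = -∑_α |Z_α|`, a norm convergent series. Multiplying by `g(H)` on both sides, and using `f ≥ θ_I`
on the support of `g`, gives the claim.
-/

noncomputable section

namespace ShearFlow

open ComplexConjugate

/-! ### Multiplication operators -/

theorem memLp_top_of_norm_le {φ : ℝ → ℂ} (hm : AEStronglyMeasurable φ volume) {C : ℝ}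
    (hC : ∀ y, ‖φ y‖ ≤ C) : MemLp φ ∞ (volume : Measure ℝ) :=
  memLp_top_of_bound hm C (.of_forall hC)

theorem norm_mulOp_le {φ : ℝ → ℂ} {C : ℝ} (hC0 : 0 ≤ C) (hC : ∀ y, ‖φ y‖ ≤ C) :
    ‖mulOp φ‖ ≤ C := by
  by_cases h : MemLp φ ∞ (volume : Measure ℝ)
  · refine ContinuousLinearMap.opNorm_le_bound _ hC0 fun u => ?_
    refine Lp.norm_le_mul_norm_of_ae_le_mul ?_
    filter_upwards [coeFn_mulOp h u] with y hy
    rw [hy, norm_mul]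
    gcongr
    exact hC y
  · simpa [mulOp, h] using hC0

theorem mulOp_mul {φ ψ : ℝ → ℂ} (hφ : MemLp φ ∞ (volume : Measure ℝ))
    (hψ : MemLp ψ ∞ (volume : Measure ℝ)) :
    mulOp φ * mulOp ψ = mulOp fun y => φ y * ψ y := by
  have h : MemLp (fun y => φ y * ψ y) ∞ (volume : Measure ℝ) := hψ.mul hφ
  ext1 u
  refine Lp.ext ?_
  filter_upwards [coeFn_mulOp h u, coeFn_mulOp hψ u, coeFn_mulOp hφ (mulOp ψ u)] with y h1 h2 h3
  rw [mul_apply_eq_comp, h1, h3, h2, mul_assoc]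

theorem mulOp_sub {φ ψ : ℝ → ℂ} (hφ : MemLp φ ∞ (volume : Measure ℝ))
    (hψ : MemLp ψ ∞ (volume : Measure ℝ)) :
    mulOp (fun y => φ y - ψ y) = mulOp φ - mulOp ψ := by
  have h : MemLp (fun y => φ y - ψ y) ∞ (volume : Measure ℝ) := hφ.sub hψ
  ext1 u
  refine Lp.ext ?_
  rw [_root_.sub_apply]
  filter_upwards [coeFn_mulOp h u, coeFn_mulOp hψ u, coeFn_mulOp hφ u,
    Lp.coeFn_sub (mulOp φ u) (mulOp ψ u)] with y h1 h2 h3 h4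
  rw [h4, Pi.sub_apply, h1, h3, h2, sub_mul]

theorem mulOp_add {φ ψ : ℝ → ℂ} (hφ : MemLp φ ∞ (volume : Measure ℝ))
    (hψ : MemLp ψ ∞ (volume : Measure ℝ)) :
    mulOp (fun y => φ y + ψ y) = mulOp φ + mulOp ψ := by
  have h : MemLp (fun y => φ y + ψ y) ∞ (volume : Measure ℝ) := hφ.add hψ
  ext1 u
  refine Lp.ext ?_
  rw [_root_.add_apply]
  filter_upwards [coeFn_mulOp h u, coeFn_mulOp hψ u, coeFn_mulOp hφ u,
    Lp.coeFn_add (mulOp φ u) (mulOp ψ u)] with y h1 h2 h3 h4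
  rw [h4, Pi.add_apply, h1, h3, h2, add_mul]

theorem mulOp_const (c : ℂ) : mulOp (fun _ => c) = c • 1 := by
  have h : MemLp (fun _ : ℝ => c) ∞ (volume : Measure ℝ) := memLp_top_const c
  ext1 u
  refine Lp.ext ?_
  filter_upwards [coeFn_mulOp h u, Lp.coeFn_smul c u] with y h1 h2
  simp only [_root_.smul_apply, one_apply_eq_self] at *
  rw [h1, h2, Pi.smul_apply, smul_eq_mul]

theorem inner_mulOp {φ : ℝ → ℂ} (hφ : MemLp φ ∞ (volume : Measure ℝ)) (u v : L2) :
    inner ℂ u (mulOp φ v) = ∫ y, φ y * (conj (u y) * v y) := by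
  rw [L2.inner_def]
  refine integral_congr_ae ?_
  filter_upwards [coeFn_mulOp hφ v] with y h1
  rw [h1, RCLike.inner_apply]
  ring

theorem star_mulOp {φ : ℝ → ℂ} (hφ : MemLp φ ∞ (volume : Measure ℝ)) :
    star (mulOp φ) = mulOp fun y => conj (φ y) := by
  have h : MemLp (fun y => conj (φ y)) ∞ (volume : Measure ℝ) := hφ.star
  rw [ContinuousLinearMap.star_eq_adjoint]
  symm
  rw [ContinuousLinearMap.eq_adjoint_iff]
  intro u v
  rw [L2.inner_def, L2.inner_def]
  refine integral_congr_ae ?_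
  filter_upwards [coeFn_mulOp hφ v, coeFn_mulOp h u] with y h1 h2
  rw [h1, h2, RCLike.inner_apply, RCLike.inner_apply]
  simp
  ring

theorem isSelfAdjoint_mulOp_ofReal (φ : ℝ → ℝ) :
    IsSelfAdjoint (mulOp fun y => (φ y : ℂ)) := by
  by_cases h : MemLp (fun y => (φ y : ℂ)) ∞ (volume : Measure ℝ)
  · rw [IsSelfAdjoint, star_mulOp h]
    simp
  · rw [mulOp, dif_neg h]
    exact .zero _

theorem mulOp_nonneg {φ : ℝ → ℝ} (hφ : ∀ y, 0 ≤ φ y) : 0 ≤ mulOp fun y => (φ y : ℂ) := by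
  by_cases h : MemLp (fun y => (φ y : ℂ)) ∞ (volume : Measure ℝ)
  · rw [ContinuousLinearMap.nonneg_iff_isPositive]
    refine ContinuousLinearMap.isPositive_def'.2 ⟨isSelfAdjoint_mulOp_ofReal φ, fun u => ?_⟩
    rw [ContinuousLinearMap.reApplyInnerSelf_apply, inner_re_symm, inner_mulOp h]
    have : ∀ y, (φ y : ℂ) * (conj (u y) * u y) = ((φ y * ‖u y‖ ^ 2 : ℝ) : ℂ) := fun y => by
      rw [RCLike.conj_mul]; push_cast; rfl
    simp_rw [this]
    rw [show (∫ y, ((φ y * ‖u y‖ ^ 2 : ℝ) : ℂ)) = ((∫ y, φ y * ‖u y‖ ^ 2 : ℝ) : ℂ) from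
      integral_ofReal]
    change 0 ≤ ∫ y, φ y * ‖u y‖ ^ 2
    exact integral_nonneg fun y => mul_nonneg (hφ y) (sq_nonneg _)
  · rw [mulOp, dif_neg h]

theorem mulOp_mono {φ ψ : ℝ → ℝ} (hφ : MemLp (fun y => (φ y : ℂ)) ∞ (volume : Measure ℝ))
    (hψ : MemLp (fun y => (ψ y : ℂ)) ∞ (volume : Measure ℝ)) (h : ∀ y, φ y ≤ ψ y) :
    (mulOp fun y => (φ y : ℂ)) ≤ mulOp fun y => (ψ y : ℂ) := by
  rw [← sub_nonneg, ← mulOp_sub hψ hφ]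
  simpa using mulOp_nonneg (φ := fun y => ψ y - φ y) fun y => sub_nonneg.2 (h y)

/-- Multiplication by bounded continuous functions, as a representation of the C⋆-algebra of
these functions on `L²(ℝ; ℂ)`. -/
def mulHom : BoundedContinuousFunction ℝ ℂ →⋆ₐ[ℂ] (L2 →L[ℂ] L2) where
  toFun φ := mulOp φ
  map_one' := by
    have := mulOp_const 1
    rwa [one_smul] at this
  map_mul' φ ψ := by
    rw [mulOp_mul (φ.memLp_top) (ψ.memLp_top)]; rfl
  map_zero' := by
    have := mulOp_const 0
    rwa [zero_smul] at this
  map_add' φ ψ := mulOp_add φ.memLp_top ψ.memLp_top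
  commutes' c := mulOp_const c
  map_star' φ := (star_mulOp φ.memLp_top).symm

/-- In an abstract C⋆-algebra, `f(a)` is compatible with characters and with representations on
Hilbert spaces. -/
theorem exists_functionalCalculus {A E : Type} [CStarAlgebra A] [NormedAddCommGroup E]
    [InnerProductSpace ℂ E] [CompleteSpace E] {a : A} (ha : IsSelfAdjoint a) {f : ℝ → ℝ}
    (hf : Continuous f) :
    ∃ c : A, (∀ ψ : A →⋆ₐ[ℂ] ℂ, ψ c = f (ψ a).re) ∧
      ∀ φ : A →⋆ₐ[ℂ] (E →L[ℂ] E), φ c = funCalc f (φ a) := by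
  refine ⟨cfc f a, fun ψ => ?_, fun φ => ?_⟩
  · have h : IsSelfAdjoint (ψ a) := ha.map ψ
    rw [StarAlgHomClass.map_cfc ψ f a (by fun_prop) (by fun_prop) ha h]
    have h2 : ψ a = algebraMap ℝ ℂ (ψ a).re := (Complex.conj_eq_iff_re.1 h).symm
    rw [h2, cfc_algebraMap]
    simp
  · rw [funCalc, StarAlgHomClass.map_cfc φ f a (by fun_prop)
      (AddMonoidHomClass.continuous_of_bound φ 1 fun x => by
        simpa using NonUnitalStarAlgHom.norm_apply_le φ x) ha (ha.map φ)]

/-- `f` of the multiplication operator by `U` is the multiplication operator by `f ∘ U`: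
multiplication is a representation of the algebra of bounded continuous functions, in which `f(U)`
is identified by means of the evaluation characters. -/
theorem funCalc_mulOp {U f : ℝ → ℝ} (hU : Continuous U) {C : ℝ} (hC : ∀ y, |U y| ≤ C)
    (hf : Continuous f) :
    funCalc f (mulOp fun y => (U y : ℂ)) = mulOp fun y => (f (U y) : ℂ) := by
  let b : BoundedContinuousFunction ℝ ℂ := BoundedContinuousFunction.ofNormedAddCommGroup
    (fun y => (U y : ℂ)) (by fun_prop) C (by simpa using hC)
  have hb : IsSelfAdjoint b := by
    ext y; simp [b]
  obtain ⟨c, h1, h2⟩ := exists_functionalCalculus (E := L2) hb hf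
  have h3 := h2 mulHom
  let ev (y : ℝ) : BoundedContinuousFunction ℝ ℂ →⋆ₐ[ℂ] ℂ :=
    { toFun := fun φ => φ y
      map_one' := rfl
      map_mul' := fun _ _ => rfl
      map_zero' := rfl
      map_add' := fun _ _ => rfl
      commutes' := fun _ => rfl
      map_star' := fun _ => rfl }
  have h4 : (c : ℝ → ℂ) = fun y => (f (U y) : ℂ) := funext fun y => h1 (ev y)
  change funCalc f (mulHom b) = _
  rw [← h3, ← h4]
  rfl

/-! ### Compactness of products of functions of position and frequency -/

section

variable {E : Type} [NormedAddCommGroup E] [InnerProductSpace ℂ E]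

theorem isCompactOperator_smulRight (l : E →L[ℂ] ℂ) (z : E) :
    IsCompactOperator (l.smulRight z) := by
  have h : IsCompactOperator (ContinuousLinearMap.toSpanSingleton ℂ z) :=
    isCompactOperator_of_locallyCompactSpace_rng _
  exact h.comp_clm l

theorem isCompactOperator_sum {ι : Type*} (s : Finset ι) {A : ι → E →L[ℂ] E}
    (h : ∀ i ∈ s, IsCompactOperator (A i)) : IsCompactOperator (∑ i ∈ s, A i : E →L[ℂ] E) :=
  Submodule.sum_mem (compactOperator (RingHom.id ℂ) E E) fun i hi => h i hi

theorem isCompactOperator_of_hasSum [CompleteSpace E] {ι : Type*} {A : ι → E →L[ℂ] E}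
    {B : E →L[ℂ] E} (h : ∀ i, IsCompactOperator (A i)) (hA : HasSum A B) : IsCompactOperator B :=
  isCompactOperator_of_tendsto hA (.of_forall fun s => isCompactOperator_sum s fun i _ => h i)

/-- The Cauchy–Schwarz and Bessel inequalities bound a finite section of `T` in an orthonormal
system by its Hilbert–Schmidt norm. -/
theorem norm_sum_smulRight_le {ι : Type*} {b : ι → E} (hb : Orthonormal ℂ b) (T : E →L[ℂ] E)
    (t : Finset ι) :
    ‖∑ i ∈ t, (innerSL ℂ (b i)).smulRight (T (b i))‖ ≤ √(∑ i ∈ t, ‖T (b i)‖ ^ 2) := by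
  refine ContinuousLinearMap.opNorm_le_bound _ (Real.sqrt_nonneg _) fun x => ?_
  simp only [FunLike.coe_sum, Finset.sum_apply, ContinuousLinearMap.smulRight_apply,
    innerSL_apply_apply]
  calc ‖∑ i ∈ t, inner ℂ (b i) x • T (b i)‖
      ≤ ∑ i ∈ t, ‖T (b i)‖ * ‖inner ℂ (b i) x‖ := by
        refine (norm_sum_le _ _).trans (Finset.sum_le_sum fun i _ => ?_)
        rw [norm_smul, mul_comm]
    _ ≤ √(∑ i ∈ t, ‖T (b i)‖ ^ 2) * √(∑ i ∈ t, ‖inner ℂ (b i) x‖ ^ 2) :=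
        Real.sum_mul_le_sqrt_mul_sqrt _ _ _
    _ ≤ √(∑ i ∈ t, ‖T (b i)‖ ^ 2) * ‖x‖ := by
        gcongr
        exact Real.sqrt_le_left (norm_nonneg x) |>.2 (hb.sum_inner_products_le x)

/-- A Hilbert–Schmidt operator is compact: it is the norm limit of its restrictions to the spans of
finitely many basis vectors. -/
theorem isCompactOperator_of_sum_norm_sq_le [CompleteSpace E] {ι : Type*}
    (b : HilbertBasis ι ℂ E) (T : E →L[ℂ] E)
    {C : ℝ} (hC : ∀ s : Finset ι, ∑ i ∈ s, ‖T (b i)‖ ^ 2 ≤ C) : IsCompactOperator T := by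
  have hs : Summable fun i => ‖T (b i)‖ ^ 2 :=
    summable_of_sum_le (fun i => sq_nonneg _) hC
  have hA : Summable fun i => (innerSL ℂ (b i)).smulRight (T (b i)) := by
    rw [summable_iff_vanishing_norm]
    intro ε hε
    obtain ⟨s, h⟩ := summable_iff_vanishing_norm.1 hs (ε ^ 2) (by positivity)
    refine ⟨s, fun t ht => (norm_sum_smulRight_le b.orthonormal T t).trans_lt ?_⟩
    rw [Real.sqrt_lt' hε]
    exact (le_abs_self _).trans_lt (h t ht)
  refine isCompactOperator_of_hasSum
    (fun i => isCompactOperator_smulRight (innerSL ℂ (b i)) (T (b i))) ?_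
  convert hA.hasSum
  ext x
  have h1 : HasSum (fun i => (innerSL ℂ (b i)).smulRight (T (b i)) x) (T x) := by
    have := (b.hasSum_repr x).mapL T
    simpa [b.repr_apply_apply] using this
  exact h1.unique (hA.hasSum.mapL (ContinuousLinearMap.apply ℂ E x))

end

theorem norm_sq_eq_integral (u : L2) : ‖u‖ ^ 2 = ∫ y, ‖u y‖ ^ 2 := by
  have h : ((‖u‖ ^ 2 : ℝ) : ℂ) = ((∫ y, ‖u y‖ ^ 2 : ℝ) : ℂ) := by
    rw [show ((∫ y, ‖u y‖ ^ 2 : ℝ) : ℂ) = ∫ y, ((‖u y‖ ^ 2 : ℝ) : ℂ) from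
      (integral_ofReal (𝕜 := ℂ)).symm]
    push_cast
    refine (inner_self_eq_norm_sq_to_K (𝕜 := ℂ) u).symm.trans ?_
    rw [L2.inner_def]
    exact integral_congr_ae (.of_forall fun y => inner_self_eq_norm_sq_to_K (𝕜 := ℂ) (u y))
  exact_mod_cast h

open Real in
/-- On `L¹ ∩ L²` the inverse Fourier transform is given by the Fourier integral. -/
theorem coeFn_fourierInv (g : L2) (hg : Integrable (g : ℝ → ℂ)) :
    (𝓕⁻ g : L2) =ᵐ[volume] 𝓕⁻ (g : ℝ → ℂ) := by
  have hc : Continuous (𝓕⁻ (g : ℝ → ℂ)) :=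
    VectorFourier.fourierIntegral_continuous Real.continuous_fourierChar
      (by fun_prop) hg
  refine ae_eq_of_integral_contDiff_smul_eq ((Lp.memLp _).locallyIntegrable (by norm_num))
    hc.locallyIntegrable fun φ h1 h2 => ?_
  have hg₁ : HasCompactSupport (Complex.ofRealCLM ∘ φ) := h2.comp_left rfl
  have hg₂ : ContDiff ℝ ∞ (Complex.ofRealCLM ∘ φ) := by fun_prop
  set ψ : 𝓢(ℝ, ℂ) := hg₁.toSchwartzMap hg₂
  have h3 := DFunLike.congr_fun (Lp.fourierInv_toTemperedDistribution_eq g) ψ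
  rw [TemperedDistribution.fourierInv_apply, Lp.toTemperedDistribution_apply,
    Lp.toTemperedDistribution_apply] at h3
  -- Both sides are tested against `φ`; the Fourier integral is moved onto the Schwartz function.
  have h4 : ∀ w : ℝ → ℂ, ∫ x, φ x • w x = ∫ x, ψ x • w x := fun w =>
    integral_congr_ae (.of_forall fun x => by simp [ψ])
  rw [h4, h4, ← h3]
  have h5 := VectorFourier.integral_fourierIntegral_smul_eq_flip (μ := volume) (ν := volume)
    (L := -innerₗ ℝ) Real.continuous_fourierChar (by fun_prop) ψ.integrable hg
  have h6 : (-innerₗ ℝ).flip = -innerₗ ℝ := by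
    ext; simp
  rw [h6] at h5
  rw [SchwartzMap.fourierInv_coe]
  exact h5

open Real in
/-- For `m, p ∈ L² ∩ L^∞` the operator `m 𝓕⁻¹ p` has the square integrable kernel
`m(y) exp (2 π i y ξ) p(ξ)`, hence is Hilbert–Schmidt. -/
theorem isCompactOperator_mulOp_fourierInv_mulOp {m p : ℝ → ℂ}
    (hm : MemLp m ∞ (volume : Measure ℝ)) (hm2 : MemLp m 2 (volume : Measure ℝ))
    (hp : MemLp p ∞ (volume : Measure ℝ)) (hp2 : MemLp p 2 (volume : Measure ℝ)) :
    IsCompactOperator (mulOp m *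
      (((Lp.fourierTransformₗᵢ ℝ ℂ).symm.toContinuousLinearEquiv : L2 →L[ℂ] L2) * mulOp p)) := by
  obtain ⟨w, b, -⟩ := exists_hilbertBasis ℂ L2
  refine isCompactOperator_of_sum_norm_sq_le b _ (C := ∫ y, ‖m y‖ ^ 2 * ∫ ξ, ‖p ξ‖ ^ 2) fun s => ?_
  set T := mulOp m *
      (((Lp.fourierTransformₗᵢ ℝ ℂ).symm.toContinuousLinearEquiv : L2 →L[ℂ] L2) * mulOp p)
  have hx : ∀ y : ℝ, MemLp (fun ξ => starRingEnd ℂ ((𝐞 (ξ * y) : ℂ) * p ξ)) 2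
      (volume : Measure ℝ) := fun y => by
    refine MemLp.star (f := fun ξ => (𝐞 (ξ * y) : ℂ) * p ξ) ?_
    refine hp2.congr_norm (AEStronglyMeasurable.mul ?_ hp2.1) (.of_forall fun ξ => by
      rw [norm_mul, Circle.norm_coe, one_mul])
    exact Continuous.aestronglyMeasurable (by fun_prop)
  have hxn : ∀ y, ‖(hx y).toLp‖ ^ 2 = ∫ ξ, ‖p ξ‖ ^ 2 := fun y => by
    rw [norm_sq_eq_integral]
    refine integral_congr_ae ?_
    filter_upwards [(hx y).coeFn_toLp] with ξ h
    rw [h, RCLike.norm_conj, norm_mul, Circle.norm_coe, one_mul]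
  -- `T v` at `y` is the inner product of `v` with the conjugate of the row `y` of the kernel.
  have hT : ∀ v : L2, ∀ᵐ y, ‖T v y‖ = ‖m y‖ * ‖inner ℂ v (hx y).toLp‖ := fun v => by
    have hi : Integrable (mulOp p v : ℝ → ℂ) :=
      (MemLp.integrable_mul hp2 (Lp.memLp v)).congr (coeFn_mulOp hp v).symm
    filter_upwards [coeFn_mulOp hm (𝓕⁻ (mulOp p v)), coeFn_fourierInv _ hi] with y h1 h2
    have h3 : T v y = m y * 𝓕⁻ (mulOp p v : ℝ → ℂ) y := by rw [← h2]; exact h1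
    rw [h3, norm_mul]
    congr 1
    rw [norm_inner_symm, L2.inner_def, Real.fourierInv_eq]
    congr 1
    refine integral_congr_ae ?_
    filter_upwards [coeFn_mulOp hp v, (hx y).coeFn_toLp] with ξ h4 h5
    rw [h4, h5, RCLike.inner_apply]
    simp [Circle.smul_def]
    ring_nf
  have hTi : ∀ v : L2, Integrable fun y => ‖T v y‖ ^ 2 := fun v =>
    (Lp.memLp (T v)).integrable_norm_pow two_ne_zero
  calc ∑ i ∈ s, ‖T (b i)‖ ^ 2 = ∑ i ∈ s, ∫ y, ‖T (b i) y‖ ^ 2 := by simp_rw [norm_sq_eq_integral]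
    _ = ∫ y, ∑ i ∈ s, ‖T (b i) y‖ ^ 2 := (integral_finsetSum s fun i _ => hTi _).symm
    _ ≤ ∫ y, ‖m y‖ ^ 2 * ∫ ξ, ‖p ξ‖ ^ 2 := by
      refine integral_mono_ae (integrable_finsetSum s fun i _ => hTi _)
        ((hm2.integrable_norm_pow two_ne_zero).mul_const _) ?_
      have h : ∀ᵐ y, ∀ i ∈ s, ‖T (b i) y‖ = ‖m y‖ * ‖inner ℂ (b i) (hx y).toLp‖ :=
        (ae_ball_iff s.countable_toSet).2 fun i _ => hT (b i)
      filter_upwards [h] with y hy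
      calc ∑ i ∈ s, ‖T (b i) y‖ ^ 2 = ‖m y‖ ^ 2 * ∑ i ∈ s, ‖inner ℂ (b i) (hx y).toLp‖ ^ 2 := by
            rw [Finset.mul_sum]
            exact Finset.sum_congr rfl fun i hi => by rw [hy i hi, mul_pow]
        _ ≤ _ := by
            rw [← hxn y]
            gcongr
            exact b.orthonormal.sum_inner_products_le _

theorem isCompactOperator_mulOp_fourierMultiplier {m p : ℝ → ℂ}
    (hm : MemLp m ∞ (volume : Measure ℝ)) (hm2 : MemLp m 2 (volume : Measure ℝ))
    (hp : MemLp p ∞ (volume : Measure ℝ)) (hp2 : MemLp p 2 (volume : Measure ℝ)) :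
    IsCompactOperator (mulOp m * fourierMultiplier p) :=
  (isCompactOperator_mulOp_fourierInv_mulOp hm hm2 hp hp2).comp_clm
    ((Lp.fourierTransformₗᵢ ℝ ℂ).toContinuousLinearEquiv : L2 →L[ℂ] L2)

/-! ### Weak derivatives -/

theorem toDistr_apply (u : L2) (φ : 𝓢(ℝ, ℂ)) : toDistr u φ = ∫ y, φ y * u y := by
  change Lp.toTemperedDistribution u φ = _
  simp

theorem toDistr_fourier (u : L2) : 𝓕 (toDistr u) = toDistr (𝓕 u) :=
  Lp.fourier_toTemperedDistribution_eq u

/-- A product with a function of temperate growth, formed in the sense of distributions, is an `L²`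
function if and only if the pointwise product is. -/
theorem toDistr_eq_smulLeftCLM_iff {p : ℝ → ℂ} (hp : p.HasTemperateGrowth) (u v : L2) :
    toDistr v = TemperedDistribution.smulLeftCLM ℂ p (toDistr u) ↔
      v =ᵐ[volume] fun ξ => p ξ * u ξ := by
  constructor
  · intro h
    have hu : LocallyIntegrable (u : ℝ → ℂ) volume := (Lp.memLp u).locallyIntegrable (by norm_num)
    have hpc : Continuous p := hp.1.continuous
    have hpu : LocallyIntegrable (fun ξ => p ξ * u ξ) volume := by
      simpa [smul_eq_mul] using hu.continuous_smul hpc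
    refine ae_eq_of_integral_contDiff_smul_eq ((Lp.memLp v).locallyIntegrable (by norm_num))
      hpu fun φ h1 h2 => ?_
    have hg₁ : HasCompactSupport (Complex.ofRealCLM ∘ φ) := h2.comp_left rfl
    have hg₂ : ContDiff ℝ ∞ (Complex.ofRealCLM ∘ φ) := by fun_prop
    have h3 := DFunLike.congr_fun h (hg₁.toSchwartzMap hg₂)
    rw [TemperedDistribution.smulLeftCLM_apply_apply, toDistr_apply, toDistr_apply] at h3
    simp only [SchwartzMap.smulLeftCLM_apply_apply hp] at h3
    simpa [mul_assoc, mul_left_comm] using h3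
  · intro h
    ext φ
    rw [TemperedDistribution.smulLeftCLM_apply_apply, toDistr_apply, toDistr_apply]
    refine integral_congr_ae ?_
    filter_upwards [h] with ξ h1
    rw [h1, SchwartzMap.smulLeftCLM_apply_apply hp, smul_eq_mul]
    ring

theorem fourier_derivCLM (w : 𝓢'(ℝ, ℂ)) : 𝓕 (TemperedDistribution.derivCLM ℂ w) =
    TemperedDistribution.smulLeftCLM ℂ (fun ξ : ℝ => 2 * Real.pi * Complex.I * ξ) (𝓕 w) := by
  have h1 : TemperedDistribution.derivCLM ℂ w = ∂_{(1 : ℝ)} w := by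
    ext φ
    rw [TemperedDistribution.lineDerivOp_apply_apply, TemperedDistribution.derivCLM_apply_apply]
    congr 2
  have h2 : (fun ξ : ℝ => 2 * Real.pi * Complex.I * ξ) =
      (2 * Real.pi * Complex.I) • (fun ξ : ℝ => ((inner ℝ ξ 1 : ℝ) : ℂ)) := by
    ext ξ
    simp
  rw [h1, TemperedDistribution.fourier_lineDerivOp_eq, h2,
    TemperedDistribution.smulLeftCLM_smul (by fun_prop)]
  rfl

/-- `v = ∂u` in the sense of distributions; equivalently `u ∈ H¹(ℝ)` with derivative `v`. -/
def IsDeriv (u v : L2) : Prop := toDistr v = TemperedDistribution.derivCLM ℂ (toDistr u)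

/-- `v = ∂²u` in the sense of distributions; equivalently `u ∈ H²(ℝ)` with second derivative
`v`. -/
def IsDeriv₂ (u v : L2) : Prop :=
  toDistr v = TemperedDistribution.derivCLM ℂ (TemperedDistribution.derivCLM ℂ (toDistr u))

theorem isDeriv_iff_fourier (u v : L2) : IsDeriv u v ↔
    (𝓕 v : L2) =ᵐ[volume] fun ξ => 2 * Real.pi * Complex.I * ξ * (𝓕 u : L2) ξ := by
  rw [← toDistr_eq_smulLeftCLM_iff (p := fun ξ : ℝ => 2 * Real.pi * Complex.I * ξ) (by fun_prop),
    ← toDistr_fourier, ← toDistr_fourier, ← fourier_derivCLM, IsDeriv]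
  exact (FourierTransform.fourierEquiv ℂ 𝓢'(ℝ, ℂ)).injective.eq_iff.symm

theorem isDeriv₂_iff_fourier (u v : L2) : IsDeriv₂ u v ↔
    (𝓕 v : L2) =ᵐ[volume] fun ξ => -((2 * Real.pi * ξ : ℝ) : ℂ) ^ 2 * (𝓕 u : L2) ξ := by
  have h : (fun ξ : ℝ => -((2 * Real.pi * ξ : ℝ) : ℂ) ^ 2) =
      (fun ξ : ℝ => 2 * Real.pi * Complex.I * ξ) * (fun ξ : ℝ => 2 * Real.pi * Complex.I * ξ) := by
    ext ξ
    simp only [Pi.mul_apply]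
    push_cast
    linear_combination (-4 * Real.pi ^ 2 * ξ ^ 2) * Complex.I_sq
  rw [← toDistr_eq_smulLeftCLM_iff (p := fun ξ : ℝ => -((2 * Real.pi * ξ : ℝ) : ℂ) ^ 2)
    (by rw [h]; exact .mul (by fun_prop) (by fun_prop)), h,
    ← TemperedDistribution.smulLeftCLM_smulLeftCLM_apply (by fun_prop) (by fun_prop),
    ← toDistr_fourier, ← toDistr_fourier, ← fourier_derivCLM, ← fourier_derivCLM, IsDeriv₂]
  exact (FourierTransform.fourierEquiv ℂ 𝓢'(ℝ, ℂ)).injective.eq_iff.symm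

theorem IsDeriv.unique {u v w : L2} (h : IsDeriv u v) (h' : IsDeriv u w) : v = w :=
  toDistr_injective (h.trans h'.symm)

theorem IsDeriv.add {u v u' v' : L2} (h : IsDeriv u v) (h' : IsDeriv u' v') :
    IsDeriv (u + u') (v + v') := by
  rw [IsDeriv, map_add, map_add, map_add, h, h']

theorem IsDeriv.smul {u v : L2} (c : ℂ) (h : IsDeriv u v) : IsDeriv (c • u) (c • v) := by
  rw [IsDeriv, map_smul, map_smul, map_smul, h]

/-- The weak derivative is a closed operator. -/
theorem isDeriv_of_tendsto {ι : Type*} {l : Filter ι} [l.NeBot] {u v : ι → L2} {u₀ v₀ : L2}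
    (h : ∀ i, IsDeriv (u i) (v i)) (hu : Tendsto u l (𝓝 u₀)) (hv : Tendsto v l (𝓝 v₀)) :
    IsDeriv u₀ v₀ := by
  have hc : Continuous (toDistr : L2 → 𝓢'(ℝ, ℂ)) :=
    (Lp.toTemperedDistributionCLM ℂ (volume : Measure ℝ) 2).continuous
  have h1 := (hc.tendsto v₀).comp hv
  have h2 := (((TemperedDistribution.derivCLM ℂ).continuous.comp hc).tendsto u₀).comp hu
  refine tendsto_nhds_unique h1 (h2.congr fun i => (h i).symm)

/-- The weak derivative is skew-symmetric on `H¹(ℝ)`. -/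
theorem IsDeriv.inner_eq {u v u' v' : L2} (h : IsDeriv u v) (h' : IsDeriv u' v') :
    inner ℂ v u' = -inner ℂ u v' := by
  rw [isDeriv_iff_fourier] at h h'
  rw [← Lp.inner_fourier_eq v, ← Lp.inner_fourier_eq u, L2.inner_def, L2.inner_def,
    ← integral_neg]
  refine integral_congr_ae ?_
  filter_upwards [h, h'] with ξ h1 h2
  rw [h1, h2, RCLike.inner_apply, RCLike.inner_apply]
  simp only [map_mul, map_ofNat, Complex.conj_ofReal, Complex.conj_I]
  ring

theorem fourier_fourierMultiplier (p : ℝ → ℂ) (u : L2) :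
    𝓕 (fourierMultiplier p u) = mulOp p (𝓕 u) :=
  (Lp.fourierTransformₗᵢ ℝ ℂ).apply_symm_apply _

theorem IsDeriv.fourierMultiplier {p : ℝ → ℂ} (hp : MemLp p ∞ (volume : Measure ℝ)) {u v : L2}
    (h : IsDeriv u v) : IsDeriv (fourierMultiplier p u) (fourierMultiplier p v) := by
  rw [isDeriv_iff_fourier] at h ⊢
  rw [fourier_fourierMultiplier, fourier_fourierMultiplier]
  filter_upwards [h, coeFn_mulOp hp (𝓕 u), coeFn_mulOp hp (𝓕 v)] with ξ h1 h2 h3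
  rw [h2, h3, h1]
  ring

/-- The fundamental theorem of calculus on `ℝ` for a function with one point of
non-differentiability. -/
theorem integral_deriv_eq_zero_of_off_point {f f' : ℝ → ℂ} (y₀ : ℝ) (hf : Continuous f)
    (hd : ∀ y, y ≠ y₀ → HasDerivAt f (f' y) y) (hi : Integrable f')
    (h0 : Tendsto f (cocompact ℝ) (𝓝 0)) : ∫ y, f' y = 0 := by
  rw [← setIntegral_univ, ← Set.Iic_union_Ioi (a := y₀),
    setIntegral_union (Iic_disjoint_Ioi le_rfl) measurableSet_Ioi hi.integrableOn hi.integrableOn,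
    integral_Iic_of_hasDerivAt_of_tendsto hf.continuousWithinAt (fun x hx => hd x hx.ne)
      hi.integrableOn (h0.mono_left atBot_le_cocompact),
    integral_Ioi_of_hasDerivAt_of_tendsto hf.continuousWithinAt (fun x hx => hd x hx.ne')
      hi.integrableOn (h0.mono_left atTop_le_cocompact)]
  ring

/-- A multiplier acting on `H¹(ℝ)`: a bounded continuous function `φ` which, away from one point,
is differentiable with bounded derivative `φ'`. -/
structure IsMultiplier (φ φ' : ℝ → ℂ) : Prop where
  continuous : Continuous φ
  bounded : ∃ C, ∀ y, ‖φ y‖ ≤ C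
  measurable_deriv : AEStronglyMeasurable φ' volume
  bounded_deriv : ∃ C, ∀ y, ‖φ' y‖ ≤ C
  hasDerivAt : ∃ y₀, ∀ y, y ≠ y₀ → HasDerivAt φ (φ' y) y

theorem IsMultiplier.memLp {φ φ' : ℝ → ℂ} (h : IsMultiplier φ φ') :
    MemLp φ ∞ (volume : Measure ℝ) :=
  memLp_top_of_norm_le h.continuous.aestronglyMeasurable h.bounded.choose_spec

theorem IsMultiplier.memLp_deriv {φ φ' : ℝ → ℂ} (h : IsMultiplier φ φ') :
    MemLp φ' ∞ (volume : Measure ℝ) :=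
  memLp_top_of_norm_le h.measurable_deriv h.bounded_deriv.choose_spec

theorem memLp_deriv_schwartz (ψ : 𝓢(ℝ, ℂ)) : MemLp (deriv ψ) 2 (volume : Measure ℝ) := by
  have h := (SchwartzMap.derivCLM ℂ ℂ ψ).memLp 2 (volume : Measure ℝ)
  rwa [show ⇑(SchwartzMap.derivCLM ℂ ℂ ψ) = deriv ψ from
    funext (SchwartzMap.derivCLM_apply ℂ ψ)] at h

/-- The product of a multiplier and a Schwartz function lies in `H¹(ℝ)`, by classical integration
by parts. -/
theorem IsMultiplier.integral_mul_schwartz {φ φ' : ℝ → ℂ} (h : IsMultiplier φ φ')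
    (ψ η : 𝓢(ℝ, ℂ)) :
    ∫ y, η y * conj (φ' y * ψ y + φ y * deriv ψ y) = -∫ y, deriv η y * conj (φ y * ψ y) := by
  obtain ⟨y₀, hd⟩ := h.hasDerivAt
  obtain ⟨C, hC⟩ := h.bounded
  have hη : MemLp η 2 (volume : Measure ℝ) := η.memLp 2
  have hη' : MemLp (deriv η) 2 (volume : Measure ℝ) := memLp_deriv_schwartz η
  have hψ : MemLp ψ 2 (volume : Measure ℝ) := ψ.memLp 2
  have hψ' : MemLp (deriv ψ) 2 (volume : Measure ℝ) := memLp_deriv_schwartz ψ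
  have h1 : MemLp (fun y => φ y * ψ y) 2 (volume : Measure ℝ) := hψ.mul h.memLp
  have h2 : MemLp (fun y => φ' y * ψ y + φ y * deriv ψ y) 2 (volume : Measure ℝ) :=
    (hψ.mul h.memLp_deriv).add (hψ'.mul h.memLp)
  have i1 : Integrable fun y => η y * conj (φ' y * ψ y + φ y * deriv ψ y) :=
    hη.integrable_mul h2.star
  have i2 : Integrable fun y => deriv η y * conj (φ y * ψ y) := hη'.integrable_mul h1.star
  rw [eq_neg_iff_add_eq_zero, ← integral_add i1 i2]
  refine integral_deriv_eq_zero_of_off_point (f := fun y => η y * conj (φ y * ψ y)) y₀ ?_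
    (fun y hy => ?_) (i1.add i2) ?_
  · have := h.continuous
    exact η.continuous.mul (Complex.continuous_conj.comp (this.mul ψ.continuous))
  · have := (η.hasDerivAt y).mul ((hd y hy).mul (ψ.hasDerivAt y)).star
    exact this.congr_deriv (add_comm _ _)
  · have hb : Tendsto (fun y => ‖η y‖ * (C * ‖ψ y‖)) (cocompact ℝ) (𝓝 0) := by
      simpa using η.tendsto_cocompact.norm.mul (ψ.tendsto_cocompact.norm.const_mul C)
    refine squeeze_zero_norm (fun y => ?_) hb
    rw [norm_mul, RCLike.norm_conj, norm_mul]
    gcongr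
    exact hC y

/-- The product rule in `H¹(ℝ)`. -/
theorem IsDeriv.mulOp {φ φ' : ℝ → ℂ} (h : IsMultiplier φ φ') {u v : L2} (hu : IsDeriv u v) :
    IsDeriv (mulOp φ u) (mulOp φ' u + mulOp φ v) := by
  have hψ (ψ : 𝓢(ℝ, ℂ)) : MemLp ψ 2 (volume : Measure ℝ) := ψ.memLp 2
  have hψ' (ψ : 𝓢(ℝ, ℂ)) : MemLp (deriv ψ) 2 (volume : Measure ℝ) :=
    memLp_deriv_schwartz ψ
  -- Skew-symmetry of `∂`, applied to `u` and to the `H¹` function `conj (φ ψ)`.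
  have key (ψ : 𝓢(ℝ, ℂ)) : ∫ y, (φ' y * ψ y + φ y * deriv ψ y) * u y =
      -∫ y, φ y * ψ y * v y := by
    have h1 : MemLp (fun y => conj (φ y * ψ y)) 2 (volume : Measure ℝ) :=
      ((hψ ψ).mul h.memLp).star
    have h2 : MemLp (fun y => conj (φ' y * ψ y + φ y * deriv ψ y)) 2 (volume : Measure ℝ) :=
      (((hψ ψ).mul h.memLp_deriv).add ((hψ' ψ).mul h.memLp)).star
    have hw : IsDeriv h1.toLp h2.toLp := by
      rw [IsDeriv]
      ext η
      rw [TemperedDistribution.derivCLM_apply_apply, map_neg, toDistr_apply, toDistr_apply]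
      convert h.integral_mul_schwartz ψ η using 1
      · refine integral_congr_ae ?_
        filter_upwards [h2.coeFn_toLp] with y hy
        rw [hy]
      · congr 1
        refine integral_congr_ae ?_
        filter_upwards [h1.coeFn_toLp] with y hy
        rw [hy, SchwartzMap.derivCLM_apply]
    have h3 := hw.inner_eq hu
    rw [L2.inner_def, L2.inner_def] at h3
    convert h3 using 1
    · refine integral_congr_ae ?_
      filter_upwards [h2.coeFn_toLp] with y hy
      rw [hy, RCLike.inner_apply, starRingEnd_self_apply, mul_comm]
    · congr 1
      refine integral_congr_ae ?_
      filter_upwards [h1.coeFn_toLp] with y hy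
      rw [hy, RCLike.inner_apply, starRingEnd_self_apply, mul_comm]
  rw [IsDeriv]
  ext ψ
  rw [TemperedDistribution.derivCLM_apply_apply, map_neg, map_add]
  change toDistr _ ψ + toDistr _ ψ = _
  simp only [toDistr_apply, SchwartzMap.derivCLM_apply]
  have e1 : ∫ y, ψ y * ShearFlow.mulOp φ' u y = ∫ y, φ' y * ψ y * u y := by
    refine integral_congr_ae ?_
    filter_upwards [coeFn_mulOp h.memLp_deriv u] with y hy
    rw [hy]; ring
  have e2 : ∫ y, ψ y * ShearFlow.mulOp φ v y = ∫ y, φ y * ψ y * v y := by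
    refine integral_congr_ae ?_
    filter_upwards [coeFn_mulOp h.memLp v] with y hy
    rw [hy]; ring
  have e3 : ∫ y, deriv ψ y * ShearFlow.mulOp φ u y = ∫ y, φ y * deriv ψ y * u y := by
    refine integral_congr_ae ?_
    filter_upwards [coeFn_mulOp h.memLp u] with y hy
    rw [hy]; ring
  have i1 : Integrable fun y => φ' y * ψ y * u y :=
    ((hψ ψ).mul h.memLp_deriv (r := 2)).integrable_mul (Lp.memLp u)
  have i2 : Integrable fun y => φ y * deriv ψ y * u y :=
    ((hψ' ψ).mul h.memLp (r := 2)).integrable_mul (Lp.memLp u)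
  have k := key ψ
  simp_rw [add_mul] at k
  rw [integral_add i1 i2] at k
  rw [e1, e2, e3]
  linear_combination k

/-! ### The resolvent of the Laplacian -/

/-- The symbol `1 / ((2πξ)² + s)` of `(s - ∂²)⁻¹`. -/
def resolventSymbol (s ξ : ℝ) : ℝ := ((2 * Real.pi * ξ) ^ 2 + s)⁻¹

/-- The resolvent `(s - ∂²)⁻¹` for `s > 0`. -/
def laplaceResolvent (s : ℝ) : L2 →L[ℂ] L2 := fourierMultiplier fun ξ => (resolventSymbol s ξ : ℂ)

theorem resolventSymbol_pos {s : ℝ} (hs : 0 < s) (ξ : ℝ) : 0 < resolventSymbol s ξ := by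
  rw [resolventSymbol]; positivity

theorem resolventSymbol_le {s : ℝ} (hs : 0 < s) (ξ : ℝ) : resolventSymbol s ξ ≤ s⁻¹ := by
  rw [resolventSymbol]
  exact inv_anti₀ hs (le_add_of_nonneg_left (sq_nonneg _))

theorem continuous_resolventSymbol {s : ℝ} (hs : 0 < s) : Continuous (resolventSymbol s) := by
  unfold resolventSymbol
  exact Continuous.inv₀ (by fun_prop) fun ξ => by positivity

theorem memLp_top_resolventSymbol {s : ℝ} (hs : 0 < s) :
    MemLp (fun ξ => (resolventSymbol s ξ : ℂ)) ∞ (volume : Measure ℝ) :=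
  memLp_top_of_norm_le (Complex.continuous_ofReal.comp
    (continuous_resolventSymbol hs)).aestronglyMeasurable (C := s⁻¹) fun ξ => by
      rw [Complex.norm_real, Real.norm_of_nonneg (resolventSymbol_pos hs ξ).le]
      exact resolventSymbol_le hs ξ

theorem memLp_two_resolventSymbol {s : ℝ} (hs : 1 ≤ s) :
    MemLp (fun ξ => (resolventSymbol s ξ : ℂ)) 2 (volume : Measure ℝ) := by
  have hs0 : 0 < s := by linarith
  have hc : AEStronglyMeasurable (fun ξ => (resolventSymbol s ξ : ℂ)) (volume : Measure ℝ) :=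
    (Complex.continuous_ofReal.comp (continuous_resolventSymbol hs0)).aestronglyMeasurable
  rw [memLp_two_iff_integrable_sq_norm hc]
  refine integrable_inv_one_add_sq.mono' (hc.norm.pow 2) (.of_forall fun ξ => ?_)
  rw [Complex.norm_real, Real.norm_of_nonneg (resolventSymbol_pos hs0 ξ).le,
    Real.norm_of_nonneg (sq_nonneg _)]
  have h1 : resolventSymbol s ξ ≤ 1 := (resolventSymbol_le hs0 ξ).trans (inv_le_one_of_one_le₀ hs)
  have h2 : resolventSymbol s ξ ≤ (1 + ξ ^ 2)⁻¹ := by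
    rw [resolventSymbol]
    refine inv_anti₀ (by positivity) ?_
    have h3 : 1 ≤ 2 * Real.pi := by linarith [Real.two_le_pi]
    have h4 : 1 * ξ ^ 2 ≤ (2 * Real.pi) ^ 2 * ξ ^ 2 :=
      mul_le_mul_of_nonneg_right (one_le_pow₀ h3) (sq_nonneg ξ)
    rw [mul_pow]
    linarith
  calc resolventSymbol s ξ ^ 2 = resolventSymbol s ξ * resolventSymbol s ξ := sq _
    _ ≤ 1 * (1 + ξ ^ 2)⁻¹ :=
      mul_le_mul h1 h2 (resolventSymbol_pos hs0 ξ).le zero_le_one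
    _ = _ := one_mul _

theorem fourier_smul_sub (c : ℂ) (u v : L2) : 𝓕 (c • u - v) = c • 𝓕 u - 𝓕 v :=
  ((Lp.fourierTransformₗᵢ ℝ ℂ).map_sub _ _).trans
    (congrArg (· - 𝓕 v) ((Lp.fourierTransformₗᵢ ℝ ℂ).map_smul c u))

theorem isDeriv₂_laplaceResolvent {s : ℝ} (hs : 0 < s) (f : L2) :
    IsDeriv₂ (laplaceResolvent s f) ((s : ℂ) • laplaceResolvent s f - f) := by
  rw [isDeriv₂_iff_fourier, fourier_smul_sub,
    laplaceResolvent, fourier_fourierMultiplier]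
  filter_upwards [coeFn_mulOp (memLp_top_resolventSymbol hs) (𝓕 f),
    Lp.coeFn_sub ((s : ℂ) • mulOp (fun ξ => (resolventSymbol s ξ : ℂ)) (𝓕 f)) (𝓕 f),
    Lp.coeFn_smul (s : ℂ) (mulOp (fun ξ => (resolventSymbol s ξ : ℂ)) (𝓕 f))] with ξ h1 h2 h3
  rw [h2, Pi.sub_apply, h3, Pi.smul_apply, h1, resolventSymbol]
  have h : (((2 * Real.pi * ξ) ^ 2 + s : ℝ) : ℂ) ≠ 0 := by
    exact_mod_cast (by positivity : (0 : ℝ) < (2 * Real.pi * ξ) ^ 2 + s).ne'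
  have h' := inv_mul_cancel₀ h
  push_cast at h' ⊢
  simp only [smul_eq_mul]
  linear_combination (𝓕 f : L2) ξ * h'

theorem IsDeriv₂.laplaceResolvent_eq {s : ℝ} (hs : 0 < s) {u v : L2} (h : IsDeriv₂ u v) :
    laplaceResolvent s ((s : ℂ) • u - v) = u := by
  rw [isDeriv₂_iff_fourier] at h
  refine (Lp.fourierTransformₗᵢ ℝ ℂ).injective ?_
  change 𝓕 (laplaceResolvent s _) = 𝓕 u
  rw [laplaceResolvent, fourier_fourierMultiplier, fourier_smul_sub]
  refine Lp.ext ?_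
  filter_upwards [coeFn_mulOp (memLp_top_resolventSymbol hs) ((s : ℂ) • 𝓕 u - 𝓕 v), h,
    Lp.coeFn_sub ((s : ℂ) • 𝓕 u) (𝓕 v), Lp.coeFn_smul (s : ℂ) (𝓕 u)] with ξ h1 h2 h3 h4
  rw [h1, h3, Pi.sub_apply, h4, Pi.smul_apply, h2, resolventSymbol]
  have h : (((2 * Real.pi * ξ) ^ 2 + s : ℝ) : ℂ) ≠ 0 := by
    exact_mod_cast (by positivity : (0 : ℝ) < (2 * Real.pi * ξ) ^ 2 + s).ne'
  have h' := inv_mul_cancel₀ h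
  push_cast at h' ⊢
  simp only [smul_eq_mul]
  linear_combination (𝓕 u : L2) ξ * h'

/-! ### Functional calculus and compact perturbations -/

section

variable {E : Type} [NormedAddCommGroup E] [InnerProductSpace ℂ E]

theorem isCompactOperator_pow_sub_pow {a b : E →L[ℂ] E} (h : IsCompactOperator (a - b)) (n : ℕ) :
    IsCompactOperator (a ^ n - b ^ n) := by
  induction n with
  | zero => simpa using isCompactOperator_zero
  | succ n ih =>
    have h1 : a ^ (n + 1) - b ^ (n + 1) = a ^ n * (a - b) + (a ^ n - b ^ n) * b := by
      noncomm_ring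
    rw [h1]
    exact (h.clm_comp (a ^ n)).add (ih.comp_clm b)

theorem isCompactOperator_aeval_sub {a b : E →L[ℂ] E} (h : IsCompactOperator (a - b))
    (p : Polynomial ℝ) : IsCompactOperator (Polynomial.aeval a p - Polynomial.aeval b p) := by
  induction p using Polynomial.induction_on' with
  | add p q hp hq =>
    rw [map_add, map_add, add_sub_add_comm]
    exact hp.add hq
  | monomial n c =>
    rw [Polynomial.aeval_monomial, Polynomial.aeval_monomial, ← mul_sub]
    exact (isCompactOperator_pow_sub_pow h n).clm_comp (algebraMap ℝ (E →L[ℂ] E) c)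

end

section

variable {E : Type} [NormedAddCommGroup E] [InnerProductSpace ℂ E] [CompleteSpace E]

theorem isSelfAdjoint_funCalc (f : ℝ → ℝ) (a : E →L[ℂ] E) : IsSelfAdjoint (funCalc f a) :=
  cfc_predicate f a

theorem abs_le_norm_of_mem_spectrum {a : E →L[ℂ] E} {x : ℝ} (hx : x ∈ spectrum ℝ a) :
    |x| ≤ ‖a‖ := by
  have : Nontrivial (E →L[ℂ] E) := by
    by_contra h
    rw [not_nontrivial_iff_subsingleton] at h
    simp at hx
  exact spectrum.norm_le_norm_of_mem hx

theorem norm_funCalc_le {f : ℝ → ℝ} {a : E →L[ℂ] E} {C : ℝ} (hC : 0 ≤ C)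
    (h : ∀ x, |x| ≤ ‖a‖ → |f x| ≤ C) : ‖funCalc f a‖ ≤ C :=
  norm_cfc_le hC fun x hx => h x (abs_le_norm_of_mem_spectrum hx)

theorem funCalc_mul {f g : ℝ → ℝ} (hf : Continuous f) (hg : Continuous g) (a : E →L[ℂ] E) :
    funCalc f a * funCalc g a = funCalc (fun x => f x * g x) a :=
  (cfc_mul f g a).symm

theorem funCalc_sub {f g : ℝ → ℝ} (hf : Continuous f) (hg : Continuous g) (a : E →L[ℂ] E) :
    funCalc (fun x => f x - g x) a = funCalc f a - funCalc g a :=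
  cfc_sub f g a

theorem funCalc_mono {f g : ℝ → ℝ} (hf : Continuous f) (hg : Continuous g) (a : E →L[ℂ] E)
    (h : ∀ x, f x ≤ g x) : funCalc f a ≤ funCalc g a :=
  cfc_mono fun x _ => h x

theorem isCompactOperator_of_forall_near {a : E →L[ℂ] E}
    (h : ∀ ε > 0, ∃ b : E →L[ℂ] E, IsCompactOperator b ∧ ‖a - b‖ < ε) : IsCompactOperator a := by
  have hc : IsClosed {f : E →L[ℂ] E | IsCompactOperator f} := isClosed_setOfPred_isCompactOperator
  refine hc.closure_subset (Metric.mem_closure_iff.2 fun ε hε => ?_)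
  obtain ⟨b, hb, hab⟩ := h ε hε
  exact ⟨b, hb, by rwa [dist_eq_norm]⟩

/-- The continuous functional calculus preserves congruence modulo compact operators. -/
theorem isCompactOperator_funCalc_sub {a b : E →L[ℂ] E} (ha : IsSelfAdjoint a)
    (hb : IsSelfAdjoint b) (h : IsCompactOperator (a - b)) {f : ℝ → ℝ} (hf : Continuous f) :
    IsCompactOperator (funCalc f a - funCalc f b) := by
  refine isCompactOperator_of_forall_near fun ε hε => ?_
  set R := max ‖a‖ ‖b‖
  obtain ⟨p, hp⟩ := exists_polynomial_near_of_continuousOn (-R) R f hf.continuousOn (ε / 4)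
    (by positivity)
  have key : ∀ c : E →L[ℂ] E, IsSelfAdjoint c → ‖c‖ ≤ R →
      ‖funCalc f c - Polynomial.aeval c p‖ ≤ ε / 4 := fun c hc hcR => by
    have h1 : Polynomial.aeval c p = funCalc (fun x => p.eval x) c :=
      (cfc_polynomial p c).symm
    rw [h1, ← funCalc_sub hf p.continuous]
    refine norm_funCalc_le (by positivity) fun x hx => ?_
    rw [abs_sub_comm]
    exact (hp x (abs_le.1 (hx.trans hcR))).le
  refine ⟨_, isCompactOperator_aeval_sub h p, ?_⟩
  calc ‖funCalc f a - funCalc f b - (Polynomial.aeval a p - Polynomial.aeval b p)‖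
      = ‖(funCalc f a - Polynomial.aeval a p) - (funCalc f b - Polynomial.aeval b p)‖ := by
        congr 1; abel
    _ ≤ ε / 4 + ε / 4 := (norm_sub_le _ _).trans
        (add_le_add (key a ha (le_max_left _ _)) (key b hb (le_max_right _ _)))
    _ < ε := by linarith

/-- A compact self-adjoint operator is bounded below by `-|R|`, where `|R|` is compact. -/
theorem exists_isCompactOperator_neg_le {R : E →L[ℂ] E} (hR : IsSelfAdjoint R)
    (hc : IsCompactOperator R) :
    ∃ P : E →L[ℂ] E, 0 ≤ P ∧ IsCompactOperator P ∧ ‖P‖ ≤ ‖R‖ ∧ -P ≤ R := by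
  refine ⟨funCalc (fun x => |x|) R, cfc_nonneg fun x _ => abs_nonneg x, ?_, ?_, ?_⟩
  · have h := isCompactOperator_funCalc_sub hR (.zero _) (by rwa [sub_zero]) continuous_abs
    have h0 : funCalc (fun x => |x|) (0 : E →L[ℂ] E) = 0 := by
      rw [funCalc, cfc_apply_zero]; simp
    rwa [h0, sub_zero] at h
  · exact norm_funCalc_le (norm_nonneg _) fun x hx => by rwa [abs_abs]
  · have h1 : funCalc (fun x => -|x|) R = -funCalc (fun x => |x|) R := cfc_neg _ R
    have h2 : funCalc (fun x => x) R = R := cfc_id' ℝ R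
    rw [← h1]
    conv_rhs => rw [← h2]
    exact funCalc_mono (by fun_prop) (by fun_prop) R fun x => neg_abs_le x

/-! ### Operator Lipschitz estimates -/

open NormedSpace in
theorem norm_exp_I_smul_le {a : E →L[ℂ] E} (ha : IsSelfAdjoint a) (t : ℝ) :
    ‖exp (((t : ℂ) * Complex.I) • a)‖ ≤ 1 := by
  have h : ((t : ℂ) * Complex.I) • a ∈ skewAdjoint (E →L[ℂ] E) := by
    rw [skewAdjoint.mem_iff, star_smul, ha.star_eq]
    simp
  rcases subsingleton_or_nontrivial (E →L[ℂ] E) with _ | _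
  · rw [Subsingleton.elim (exp _) (0 : E →L[ℂ] E), norm_zero]
    exact zero_le_one
  · let : NormedAlgebra ℚ (E →L[ℂ] E) := .restrictScalars ℚ ℂ _
    exact (CStarRing.norm_of_mem_unitary (exp_mem_unitary_of_mem_skewAdjoint h)).le

open NormedSpace in
/-- `‖exp (ita) - exp (itb)‖ ≤ |t| ‖a - b‖`, by Duhamel's formula. -/
theorem norm_exp_sub_exp_le {a b : E →L[ℂ] E} (ha : IsSelfAdjoint a) (hb : IsSelfAdjoint b)
    (t : ℝ) : ‖exp (((t : ℂ) * Complex.I) • a) - exp (((t : ℂ) * Complex.I) • b)‖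
      ≤ |t| * ‖a - b‖ := by
  set u : (E →L[ℂ] E) → ℝ → E →L[ℂ] E := fun c s => exp (((s : ℂ) * Complex.I) • c) with hu
  have hs : ∀ c s, u c s = exp (s • (Complex.I • c)) := fun c s => by
    simp only [hu, mul_smul, Complex.coe_smul]
  have hd : ∀ c s, HasDerivAt (u c) (u c s * (Complex.I • c)) s := fun c s => by
    have := hasDerivAt_exp_smul_const (𝕂 := ℝ) (Complex.I • c) s
    rw [← hs] at this
    exact this.congr_of_eventuallyEq (.of_forall fun r => hs c r)
  have hd' : ∀ c s, HasDerivAt (u c) ((Complex.I • c) * u c s) s := fun c s => by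
    have := hasDerivAt_exp_smul_const' (𝕂 := ℝ) (Complex.I • c) s
    rw [← hs] at this
    exact this.congr_of_eventuallyEq (.of_forall fun r => hs c r)
  have h1 : ∀ s, HasDerivAt (fun s => u a s * u b (t - s))
      (u a s * (Complex.I • (a - b)) * u b (t - s)) s := fun s => by
    have := (hd a s).mul ((hd' b (t - s)).scomp s ((hasDerivAt_id s).const_sub t))
    refine this.congr_deriv ?_
    simp only [Function.comp_apply, neg_smul, one_smul, smul_sub]
    noncomm_ring
  have h2 := Convex.norm_image_sub_le_of_norm_hasDerivWithin_le (C := ‖a - b‖)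
    (fun s _ => (h1 s).hasDerivWithinAt) (fun s _ => ?_) convex_univ (mem_univ 0) (mem_univ t)
  · have h0 : ∀ c, u c 0 = 1 := fun c => by simp [hu]
    rw [sub_self, h0, mul_one, sub_zero, h0, one_mul, Real.norm_eq_abs, mul_comm] at h2
    exact h2
  · calc ‖u a s * (Complex.I • (a - b)) * u b (t - s)‖
        ≤ ‖u a s‖ * ‖Complex.I • (a - b)‖ * ‖u b (t - s)‖ := norm_mul₃_le
      _ ≤ 1 * ‖Complex.I • (a - b)‖ * 1 := by
          gcongr
          · exact norm_exp_I_smul_le ha s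
          · exact norm_exp_I_smul_le hb (t - s)
      _ = ‖a - b‖ := by rw [norm_smul, Complex.norm_I, one_mul, one_mul, mul_one]

open NormedSpace in
theorem cfc_const_mul_exp {a : E →L[ℂ] E} (ha : IsSelfAdjoint a) (w c : ℂ) :
    cfc (fun z : ℂ => w * Complex.exp (c * z)) a = w • exp (c • a) := by
  have hn : IsStarNormal a := ha.isStarNormal
  rw [cfc_const_mul _ _ a (by fun_prop)]
  congr 1
  have hn' : IsStarNormal (c • a) := inferInstance
  rw [← CFC.complex_exp_eq_normedSpace_exp hn']
  exact cfc_comp_const_mul _ Complex.exp a (by fun_prop)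

open NormedSpace in
/-- The functional calculus of a Schwartz function as a superposition of unitary groups. -/
theorem funCalc_eq_integral {a : E →L[ℂ] E} (ha : IsSelfAdjoint a) {f : ℝ → ℝ} (φ : 𝓢(ℝ, ℂ))
    (hφ : ∀ x, φ x = f x) :
    Integrable (fun t : ℝ => (𝓕 φ) t • exp (((2 * Real.pi * t : ℝ) * Complex.I) • a)) ∧
    funCalc f a = ∫ t : ℝ, (𝓕 φ) t • exp (((2 * Real.pi * t : ℝ) * Complex.I) • a) := by
  have hn : IsStarNormal a := ha.isStarNormal
  set e : ℝ → ℂ → ℂ := fun t z => (𝓕 φ) t * Complex.exp ((2 * Real.pi * t : ℝ) * Complex.I * z)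
    with he
  have h1 : (fun t : ℝ => (𝓕 φ) t • exp (((2 * Real.pi * t : ℝ) * Complex.I) • a)) =
      fun t => cfc (e t) a := funext fun t => (cfc_const_mul_exp ha _ _).symm
  have hre : ∀ z ∈ spectrum ℂ a, z = (z.re : ℂ) := fun z hz => ha.mem_spectrum_eq_re hz
  have hb : ∀ᵐ t : ℝ, ∀ z ∈ spectrum ℂ a, ‖e t z‖ ≤ ‖(𝓕 φ) t‖ :=
    .of_forall fun t z hz => by
      rw [he, norm_mul, hre z hz, show ((2 * Real.pi * t : ℝ) * Complex.I * (z.re : ℂ)) =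
        ((2 * Real.pi * t * z.re : ℝ) : ℂ) * Complex.I by push_cast; ring,
        Complex.norm_exp_ofReal_mul_I, mul_one]
  have hc : Continuous (Function.uncurry e) := by
    have := (𝓕 φ).continuous
    unfold Function.uncurry
    fun_prop
  have hfi : HasFiniteIntegral (fun t => ‖(𝓕 φ) t‖) := (𝓕 φ).integrable.norm.2
  have hfe : funCalc f a = cfc (fun z : ℂ => ∫ t, e t z) a := by
    rw [funCalc, cfc_real_eq_complex f ha]
    refine cfc_congr fun z hz => ?_
    have h4 : φ z.re = 𝓕⁻ (𝓕 φ) z.re := by rw [FourierTransform.fourierInv_fourier_eq]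
    rw [← hφ, h4, SchwartzMap.fourierInv_coe, Real.fourierInv_eq']
    refine integral_congr_ae (.of_forall fun t => ?_)
    have h5 : ((2 * Real.pi * t : ℝ) : ℂ) * Complex.I * z =
        ((2 * Real.pi * inner ℝ t z.re : ℝ) : ℂ) * Complex.I := by
      conv_lhs => rw [hre z hz]
      simp only [RCLike.inner_apply, conj_trivial]
      push_cast
      ring
    simp only [he]
    rw [h5, smul_eq_mul, mul_comm]
  rw [h1, hfe]
  exact ⟨integrable_cfc e _ a hc.continuousOn hb hfi hn,
    cfc_integral e _ a hc.continuousOn hb hfi hn⟩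

/-- A Schwartz function is operator Lipschitz. -/
theorem exists_norm_funCalc_sub_le {f : ℝ → ℝ} (φ : 𝓢(ℝ, ℂ)) (hφ : ∀ x, φ x = f x) :
    ∃ C : ℝ, 0 ≤ C ∧ ∀ a b : E →L[ℂ] E, IsSelfAdjoint a → IsSelfAdjoint b →
      ‖funCalc f a - funCalc f b‖ ≤ C * ‖a - b‖ := by
  have hi : Integrable fun t : ℝ => ‖(𝓕 φ) t‖ * (2 * Real.pi * |t|) := by
    have h := ((𝓕 φ).integrable_pow_mul volume 1).const_mul (2 * Real.pi)
    refine h.congr (.of_forall fun t => ?_)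
    simp only [pow_one, Real.norm_eq_abs]
    ring
  refine ⟨∫ t : ℝ, ‖(𝓕 φ) t‖ * (2 * Real.pi * |t|), integral_nonneg fun t => by positivity,
    fun a b ha hb => ?_⟩
  obtain ⟨i1, h1⟩ := funCalc_eq_integral ha φ hφ
  obtain ⟨i2, h2⟩ := funCalc_eq_integral hb φ hφ
  rw [h1, h2, ← integral_sub i1 i2, ← integral_mul_const]
  refine norm_integral_le_of_norm_le (hi.mul_const _) (.of_forall fun t => ?_)
  rw [← smul_sub, norm_smul]
  refine (mul_le_mul_of_nonneg_left ?_ (norm_nonneg _)).trans_eq (mul_assoc _ _ _).symm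
  refine (norm_exp_sub_exp_le ha hb _).trans_eq ?_
  rw [abs_mul, abs_of_pos (by positivity : 0 < 2 * Real.pi)]

end

/-! ### The binomial series of the square root -/

/-- The Taylor coefficients of `√(1 - x)` at `0`. -/
def sqrtCoeff (n : ℕ) : ℝ := (-1) ^ n * Ring.choose (1 / 2 : ℝ) n

theorem hasSum_sqrtCoeff {x : ℝ} (hx : |x| < 1) :
    HasSum (fun n => sqrtCoeff n * x ^ n) (√(1 - x)) := by
  have h := (Real.one_add_rpow_hasFPowerSeriesOnBall_zero (a := 1 / 2)).hasSum (y := -x) (by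
    rw [Metric.mem_eball, edist_dist, dist_zero_right, norm_neg, Real.norm_eq_abs]
    exact ENNReal.ofReal_lt_one.2 hx)
  rw [zero_add, ← sub_eq_add_neg, ← Real.sqrt_eq_rpow] at h
  have e : (fun n => sqrtCoeff n * x ^ n) =
      fun n => binomialSeries ℝ (1 / 2 : ℝ) n fun _ => -x := by
    ext n
    rw [binomialSeries_apply, List.prod_ofFn]
    simp only [sqrtCoeff, Finset.prod_const, Finset.card_univ, Fintype.card_fin, smul_eq_mul]
    rw [neg_pow x]
    ring
  rw [e]
  exact h

theorem summable_sqrtCoeff {q : ℝ} (h0 : 0 ≤ q) (h1 : q < 1) (k : ℕ) :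
    Summable fun n : ℕ => |sqrtCoeff n| * (n ^ k * q ^ n) := by
  obtain ⟨r, hqr, hr1⟩ := exists_between h1
  have hr0 : 0 < r := h0.trans_lt hqr
  have hs := (hasSum_sqrtCoeff (x := r) (by rwa [abs_of_pos hr0])).summable
  obtain ⟨M, hM⟩ := hs.tendsto_atTop_zero.norm.bddAbove_range
  have hg : Summable fun n : ℕ => (n : ℝ) ^ k * (q / r) ^ n :=
    summable_pow_mul_geometric_of_norm_lt_one k (by
      rw [Real.norm_of_nonneg (by positivity)]; exact (div_lt_one hr0).2 hqr)
  refine Summable.of_nonneg_of_le (fun n => by positivity) (fun n => ?_) (hg.mul_left M)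
  have h2 : |sqrtCoeff n| * r ^ n ≤ M := by
    have := hM ⟨n, rfl⟩
    simpa [abs_mul, abs_of_pos hr0] using this
  calc |sqrtCoeff n| * (n ^ k * q ^ n) = (|sqrtCoeff n| * r ^ n) * (n ^ k * (q / r) ^ n) := by
        rw [div_pow]; field_simp
    _ ≤ M * (n ^ k * (q / r) ^ n) := by gcongr

section

variable {E : Type} [NormedAddCommGroup E] [InnerProductSpace ℂ E] [CompleteSpace E]

theorem opSqrt_eq_funCalc {T : E →L[ℂ] E} (hT : 0 ≤ T) (hT1 : ‖T‖ < 1) :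
    opSqrt (1 - T) = funCalc (fun x => √(1 - x)) T := by
  have hs : IsSelfAdjoint T := .of_nonneg hT
  refine CFC.sqrt_unique ?_ (cfc_nonneg fun x _ => Real.sqrt_nonneg _)
  change funCalc _ T * funCalc _ T = _
  rw [funCalc_mul (by fun_prop) (by fun_prop)]
  have h1 : funCalc (fun x => √(1 - x) * √(1 - x)) T = funCalc (fun x => 1 - x) T := by
    refine cfc_congr fun x hx => ?_
    have := (le_abs_self x).trans (abs_le_norm_of_mem_spectrum hx)
    exact Real.mul_self_sqrt (by linarith)
  rw [h1, funCalc_sub (by fun_prop) (by fun_prop)]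
  congr 1
  · exact cfc_const_one ℝ T
  · exact cfc_id' ℝ T

theorem isSelfAdjoint_opSqrt (B : E →L[ℂ] E) : IsSelfAdjoint (opSqrt B) :=
  .of_nonneg (CFC.sqrt_nonneg B)

theorem norm_opSqrt_le {T : E →L[ℂ] E} (hT : 0 ≤ T) (hT1 : ‖T‖ < 1) :
    ‖opSqrt (1 - T)‖ ≤ 1 := by
  rw [opSqrt_eq_funCalc hT hT1]
  refine norm_cfc_le zero_le_one fun x hx => ?_
  have h0 : 0 ≤ x := spectrum_nonneg_of_nonneg hT hx
  rw [Real.norm_of_nonneg (Real.sqrt_nonneg _), Real.sqrt_le_left zero_le_one]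
  linarith

theorem norm_opSqrt_sub_one_le {T : E →L[ℂ] E} (hT : 0 ≤ T) (hT1 : ‖T‖ < 1) :
    ‖opSqrt (1 - T) - 1‖ ≤ ‖T‖ := by
  have hs : IsSelfAdjoint T := .of_nonneg hT
  have h1 : (1 : E →L[ℂ] E) = funCalc (fun _ => 1) T := (cfc_const_one ℝ T).symm
  have h2 : opSqrt (1 - T) - 1 = funCalc (fun x => √(1 - x) - 1) T := by
    rw [funCalc_sub (by fun_prop) (by fun_prop), ← opSqrt_eq_funCalc hT hT1, ← h1]
  rw [h2]
  refine norm_funCalc_le (norm_nonneg _) fun x hx => le_trans ?_ hx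
  have hx1 : 0 ≤ 1 - x := by linarith [(le_abs_self x).trans hx]
  have h3 : (√(1 - x) - 1) * (√(1 - x) + 1) = -x := by
    linear_combination Real.mul_self_sqrt hx1
  calc |√(1 - x) - 1| ≤ |√(1 - x) - 1| * (√(1 - x) + 1) :=
        le_mul_of_one_le_right (abs_nonneg _) (by linarith [Real.sqrt_nonneg (1 - x)])
    _ = |x| := by
        rw [← abs_neg x, ← h3, abs_mul, abs_of_nonneg (by positivity : 0 ≤ √(1 - x) + 1)]

/-- `(1 - T)^{1/2} - 1` is a continuous function of `T` that vanishes at `0`, hence compact when `T`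
is. -/
theorem isCompactOperator_opSqrt_sub_one {T : E →L[ℂ] E} (hT : 0 ≤ T) (hT1 : ‖T‖ < 1)
    (hc : IsCompactOperator T) : IsCompactOperator (opSqrt (1 - T) - 1 : E →L[ℂ] E) := by
  have h := isCompactOperator_funCalc_sub (.of_nonneg hT) (.zero _) (by rwa [sub_zero])
    (f := fun x => √(1 - x)) (by fun_prop)
  have h0 : funCalc (fun x => √(1 - x)) (0 : E →L[ℂ] E) = 1 := by
    rw [funCalc, cfc_apply_zero]; simp
  rwa [h0, ← opSqrt_eq_funCalc hT hT1] at h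

/-- The binomial series of `(1 - T)^{1/2}`, convergent in norm for `‖T‖ < 1`. -/
theorem hasSum_opSqrt {T : E →L[ℂ] E} (hT : 0 ≤ T) (hT1 : ‖T‖ < 1) :
    HasSum (fun n => (sqrtCoeff n : ℂ) • T ^ n) (opSqrt (1 - T)) := by
  have hs : IsSelfAdjoint T := .of_nonneg hT
  have hq := summable_sqrtCoeff (norm_nonneg T) hT1 0
  simp only [pow_zero, one_mul] at hq
  have hsum : Summable fun n => (sqrtCoeff n : ℂ) • T ^ n := by
    refine Summable.of_norm_bounded hq fun n => ?_
    rw [norm_smul, Complex.norm_real, Real.norm_eq_abs]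
    gcongr
    rcases n with _ | n
    · rw [pow_zero, pow_zero]
      exact ContinuousLinearMap.norm_id_le
    · exact norm_pow_le' T n.succ_pos
  have hfin : ∀ N, ∑ n ∈ Finset.range N, (sqrtCoeff n : ℂ) • T ^ n =
      funCalc (fun x => ∑ n ∈ Finset.range N, sqrtCoeff n * x ^ n) T := fun N => by
    have h1 : (fun x : ℝ => ∑ n ∈ Finset.range N, sqrtCoeff n * x ^ n) =
        (∑ n ∈ Finset.range N, Polynomial.monomial n (sqrtCoeff n)).eval := by
      ext x
      simp [Polynomial.eval_finsetSum]
    have h2 : funCalc (∑ n ∈ Finset.range N, Polynomial.monomial n (sqrtCoeff n)).eval T =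
        Polynomial.aeval T (∑ n ∈ Finset.range N, Polynomial.monomial n (sqrtCoeff n)) :=
      cfc_polynomial _ T
    rw [h1, h2, map_sum]
    refine Finset.sum_congr rfl fun n _ => ?_
    rw [Polynomial.aeval_monomial, ← Algebra.smul_def]
    exact Complex.coe_smul _ _
  have hlim : Tendsto (fun N => ∑ n ∈ Finset.range N, (sqrtCoeff n : ℂ) • T ^ n) atTop
      (𝓝 (funCalc (fun x => √(1 - x)) T)) := by
    simp_rw [hfin]
    refine tendsto_cfc_fun ?_ ?_
    · have := tendstoUniformlyOn_tsum_nat (f := fun n (x : ℝ) => sqrtCoeff n * x ^ n)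
        (s := spectrum ℝ T) hq (fun n x hx => ?_)
      · refine this.congr_right fun x hx => ?_
        have h3 := (abs_le_norm_of_mem_spectrum hx).trans_lt hT1
        exact (hasSum_sqrtCoeff h3).tsum_eq
      · rw [norm_mul, Real.norm_eq_abs, norm_pow, Real.norm_eq_abs]
        gcongr
        exact abs_le_norm_of_mem_spectrum hx
    · exact .of_forall fun N => by fun_prop
  rw [opSqrt_eq_funCalc hT hT1, ← tendsto_nhds_unique hsum.hasSum.tendsto_sum_nat hlim]
  exact hsum.hasSum

end

/-! ### Commutators with the derivative -/

/-- The commutator `[∂, B]` of the weak derivative with a bounded operator `B` is the bounded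
operator `D`: `B` maps `H¹(ℝ)` to itself and `∂ B u = B ∂ u + D u` there. -/
def HasComm (B D : L2 →L[ℂ] L2) : Prop :=
  ∀ u v, IsDeriv u v → IsDeriv (B u) (B v + D u)

theorem HasComm.one : HasComm 1 0 := fun u v h => by
  simpa using h

theorem HasComm.zero : HasComm 0 0 := fun u v h => by
  simp [IsDeriv]

theorem HasComm.add {B D B' D' : L2 →L[ℂ] L2} (h : HasComm B D) (h' : HasComm B' D') :
    HasComm (B + B') (D + D') := fun u v hu => by
  have := (h u v hu).add (h' u v hu)
  rwa [add_add_add_comm] at this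

theorem HasComm.smul {B D : L2 →L[ℂ] L2} (c : ℂ) (h : HasComm B D) :
    HasComm (c • B) (c • D) := fun u v hu => by
  have := (h u v hu).smul c
  rwa [smul_add] at this

theorem HasComm.mul {B D B' D' : L2 →L[ℂ] L2} (h : HasComm B D) (h' : HasComm B' D') :
    HasComm (B * B') (B * D' + D * B') := fun u v hu => by
  have := h _ _ (h' u v hu)
  rwa [map_add, add_assoc] at this

theorem HasComm.sum {ι : Type*} (s : Finset ι) {B D : ι → L2 →L[ℂ] L2}
    (h : ∀ i, HasComm (B i) (D i)) : HasComm (∑ i ∈ s, B i) (∑ i ∈ s, D i) := by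
  classical
  induction s using Finset.induction_on with
  | empty => simpa using HasComm.zero
  | insert i s hi ih =>
    rw [Finset.sum_insert hi, Finset.sum_insert hi]
    exact (h i).add ih

/-- The commutator with `∂` passes to norm limits, since `∂` is closed. -/
theorem HasComm.hasSum {ι : Type*} {B D : ι → L2 →L[ℂ] L2} {B₀ D₀ : L2 →L[ℂ] L2}
    (h : ∀ i, HasComm (B i) (D i)) (hB : HasSum B B₀) (hD : HasSum D D₀) :
    HasComm B₀ D₀ := fun u v hu => by
  have ev : ∀ {C : ι → L2 →L[ℂ] L2} {C₀ : L2 →L[ℂ] L2} (w : L2), HasSum C C₀ →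
      Tendsto (fun s : Finset ι => (∑ i ∈ s, C i) w) atTop (𝓝 (C₀ w)) := fun w hC =>
    ((ContinuousLinearMap.apply ℂ L2 w).continuous.tendsto _).comp hC
  exact isDeriv_of_tendsto (fun s => HasComm.sum s h u v hu) (ev u hB)
    ((ev v hB).add (ev u hD))

section

variable {A : Type*} [NormedRing A]

/-- The derivative of `T ^ n` for a derivation mapping `T` to `D`. -/
def powComm (T D : A) (n : ℕ) : A := ∑ k ∈ Finset.range n, T ^ k * D * T ^ (n - 1 - k)

theorem powComm_succ (T D : A) (n : ℕ) :
    powComm T D (n + 1) = T ^ n * D + powComm T D n * T := by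
  rw [powComm, Finset.sum_range_succ, powComm, Finset.sum_mul, add_comm]
  congr 1
  · simp
  · refine Finset.sum_congr rfl fun k hk => ?_
    have hk' := Finset.mem_range.1 hk
    rw [mul_assoc _ _ T, ← pow_succ]
    congr 2
    omega

/-- The hypothesis on `1` covers the zero ring, in which `‖1‖ = 0`. -/
theorem norm_powComm_le (h1 : ‖(1 : A)‖ ≤ 1) (T D : A) (n : ℕ) :
    ‖powComm T D n‖ ≤ n * ‖T‖ ^ (n - 1) * ‖D‖ := by
  have hp (k : ℕ) : ‖T ^ k‖ ≤ ‖T‖ ^ k := by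
    rcases k with _ | k
    · simpa using h1
    · exact norm_pow_le' T k.succ_pos
  calc ‖powComm T D n‖ ≤ ∑ k ∈ Finset.range n, ‖T‖ ^ (n - 1) * ‖D‖ := by
        refine (norm_sum_le _ _).trans (Finset.sum_le_sum fun k hk => ?_)
        have hk' := Finset.mem_range.1 hk
        calc ‖T ^ k * D * T ^ (n - 1 - k)‖ ≤ ‖T ^ k‖ * ‖D‖ * ‖T ^ (n - 1 - k)‖ := norm_mul₃_le
          _ ≤ ‖T‖ ^ k * ‖D‖ * ‖T‖ ^ (n - 1 - k) := by
              gcongr <;> exact hp _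
          _ = ‖T‖ ^ (n - 1) * ‖D‖ := by
              rw [mul_right_comm, ← pow_add]
              congr 2
              omega
    _ = n * ‖T‖ ^ (n - 1) * ‖D‖ := by simp [mul_assoc]

theorem isSelfAdjoint_powComm [StarRing A] {T D : A} (hT : IsSelfAdjoint T) (hD : IsSelfAdjoint D)
    (n : ℕ) : IsSelfAdjoint (powComm T D n) := by
  rw [IsSelfAdjoint, powComm, star_sum, ← Finset.sum_range_reflect]
  refine Finset.sum_congr rfl fun k hk => ?_
  have hk' := Finset.mem_range.1 hk
  rw [star_mul, star_mul, star_pow, star_pow, hT.star_eq, hD.star_eq, mul_assoc]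
  congr 3
  omega

end

theorem HasComm.pow {T D : L2 →L[ℂ] L2} (h : HasComm T D) (n : ℕ) :
    HasComm (T ^ n) (powComm T D n) := by
  induction n with
  | zero => simpa [powComm] using HasComm.one
  | succ n ih =>
    rw [powComm_succ, pow_succ]
    exact ih.mul h

/-- The commutator of `∂` with `(1 - T)^{1/2}`, computed from the binomial series. The bound is
uniform over `T` with `‖T‖ ≤ q` and linear in `[∂, T]`. -/
theorem HasComm.exists_opSqrt {q : ℝ} (hq0 : 0 < q) (hq1 : q < 1) :
    ∃ C : ℝ, 0 ≤ C ∧ ∀ T D : L2 →L[ℂ] L2, 0 ≤ T → ‖T‖ ≤ q → HasComm T D → IsSelfAdjoint D →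
      IsCompactOperator D → ∃ D' : L2 →L[ℂ] L2, HasComm (opSqrt (1 - T)) D' ∧ IsSelfAdjoint D' ∧
        IsCompactOperator D' ∧ ‖D'‖ ≤ C * ‖D‖ := by
  have hs := (summable_sqrtCoeff hq0.le hq1 1).mul_left q⁻¹
  refine ⟨∑' n, q⁻¹ * (|sqrtCoeff n| * ((n : ℝ) ^ 1 * q ^ n)),
    tsum_nonneg fun n => by positivity, fun T D hT hTq h hD hc => ?_⟩
  have hb : ∀ n, ‖(sqrtCoeff n : ℂ) • powComm T D n‖ ≤
      q⁻¹ * (|sqrtCoeff n| * ((n : ℝ) ^ 1 * q ^ n)) * ‖D‖ := fun n => by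
    rw [norm_smul, Complex.norm_real, Real.norm_eq_abs]
    calc |sqrtCoeff n| * ‖powComm T D n‖ ≤ |sqrtCoeff n| * (n * q ^ (n - 1) * ‖D‖) := by
          gcongr
          refine (norm_powComm_le ContinuousLinearMap.norm_id_le T D n).trans ?_
          gcongr
      _ = _ := by
          rcases n with _ | n
          · simp
          · rw [Nat.add_sub_cancel, pow_one, pow_succ]
            field_simp
  have hsum := Summable.of_norm_bounded (hs.mul_right ‖D‖) hb
  have hTs : IsSelfAdjoint T := .of_nonneg hT
  refine ⟨_, HasComm.hasSum (fun n => (h.pow n).smul _)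
    (hasSum_opSqrt hT (hTq.trans_lt hq1)) hsum.hasSum, ?_, ?_, ?_⟩
  · rw [IsSelfAdjoint, tsum_star]
    refine tsum_congr fun n => ?_
    rw [star_smul, (isSelfAdjoint_powComm hTs hD n).star_eq]
    simp
  · refine isCompactOperator_of_hasSum (fun n => ?_) hsum.hasSum
    have hn : IsCompactOperator (powComm T D n : L2 →L[ℂ] L2) :=
      isCompactOperator_sum (A := fun k => T ^ k * D * T ^ (n - 1 - k)) _ fun k _ =>
        (hc.clm_comp (T ^ k)).comp_clm (T ^ (n - 1 - k))
    exact IsCompactOperator.smul hn (sqrtCoeff n : ℂ)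
  · rw [← tsum_mul_right]
    exact tsum_of_norm_bounded (hs.mul_right ‖D‖).hasSum hb

/-! ### Regularity of the shear profile -/

section

variable {U : ℝ → ℝ} {Um Up : ℝ}

theorem H1.strictMono (h : H1 U Um Up) : StrictMono U := strictMono_of_deriv_pos h.deriv_pos

theorem H1.mem_Ioo (h : H1 U Um Up) (y : ℝ) : U y ∈ Ioo Um Up := by
  constructor
  · exact (h.strictMono.monotone.le_of_tendsto h.tendsto_atBot (y - 1)).trans_lt
      (h.strictMono (by linarith))
  · exact (h.strictMono (by linarith : y < y + 1)).trans_le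
      (h.strictMono.monotone.ge_of_tendsto h.tendsto_atTop (y + 1))

theorem H1.abs_le (h : H1 U Um Up) (y : ℝ) : |U y| ≤ max |Um| |Up| :=
  abs_le_max_abs_abs (h.mem_Ioo y).1.le (h.mem_Ioo y).2.le

theorem H1.range_eq (h : H1 U Um Up) : range U = Ioo Um Up := by
  refine Subset.antisymm (range_subset_iff.2 h.mem_Ioo) fun u hu => ?_
  obtain ⟨y₁, h₁⟩ := (h.tendsto_atBot.eventually_lt_const hu.1).exists
  obtain ⟨y₂, h₂⟩ := (h.tendsto_atTop.eventually_const_lt hu.2).exists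
  exact mem_range_of_exists_le_of_exists_ge h.smooth.continuous ⟨y₁, h₁.le⟩ ⟨y₂, h₂.le⟩

/-- `U` has at most one zero; away from it `m` is differentiable by the quotient rule. -/
theorem H1.exists_ne_zero (h : H1 U Um Up) : ∃ y₀, ∀ y, y ≠ y₀ → U y ≠ 0 := by
  by_cases h0 : ∃ y₀, U y₀ = 0
  · obtain ⟨y₀, h0⟩ := h0
    exact ⟨y₀, fun y hy h1 => hy (h.strictMono.injective (h1.trans h0.symm))⟩
  · push Not at h0
    exact ⟨0, fun y _ => h0 y⟩

theorem H1.continuous_iteratedDeriv (h : H1 U Um Up) (k : ℕ) : Continuous (iteratedDeriv k U) :=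
  h.smooth.continuous_iteratedDeriv k (by exact_mod_cast le_top)

theorem H1.hasDerivAt_iteratedDeriv (h : H1 U Um Up) (k : ℕ) (y : ℝ) :
    HasDerivAt (iteratedDeriv k U) (iteratedDeriv (k + 1) U y) y := by
  rw [iteratedDeriv_succ]
  exact (h.smooth.differentiable_iteratedDeriv k
    (by exact_mod_cast WithTop.coe_lt_top _) y).hasDerivAt

theorem H1.hasDerivAt (h : H1 U Um Up) (y : ℝ) : HasDerivAt U (deriv U y) y := by
  simpa using h.hasDerivAt_iteratedDeriv 0 y

theorem H1.iteratedDeriv_two_mul_neg (h : H1 U Um Up) {y : ℝ} (hy : U y ≠ 0) :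
    iteratedDeriv 2 U y * U y < 0 := by
  have h1 := h.ratio_neg y
  rw [curvatureRatio, if_neg hy] at h1
  have h2 : iteratedDeriv 2 U y * U y = iteratedDeriv 2 U y / U y * U y ^ 2 := by
    field_simp
  rw [h2]
  exact mul_neg_of_neg_of_pos h1 (by positivity)

/-- The second derivative changes sign at the zero of `U`, hence vanishes there. -/
theorem H1.iteratedDeriv_two_eq_zero (h : H1 U Um Up) {y : ℝ} (hy : U y = 0) :
    iteratedDeriv 2 U y = 0 := by
  have hc := (h.continuous_iteratedDeriv 2).continuousAt (x := y)
  refine le_antisymm ?_ ?_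
  · refine le_of_tendsto (hc.mono_left (nhdsWithin_le_nhds (s := Ioi y))) ?_
    filter_upwards [self_mem_nhdsWithin] with x hx
    have hx' : 0 < U x := hy ▸ h.strictMono hx
    have := h.iteratedDeriv_two_mul_neg hx'.ne'
    exact (neg_of_mul_neg_left this hx'.le).le
  · refine ge_of_tendsto (hc.mono_left (nhdsWithin_le_nhds (s := Iio y))) ?_
    filter_upwards [self_mem_nhdsWithin] with x hx
    have hx' : U x < 0 := hy ▸ h.strictMono hx
    have := h.iteratedDeriv_two_mul_neg hx'.ne
    nlinarith

theorem H1.sq_m (h : H1 U Um Up) (y : ℝ) : m U y ^ 2 = -curvatureRatio U y :=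
  Real.sq_sqrt (by linarith [h.ratio_neg y])

theorem H1.iteratedDeriv_two_eq (h : H1 U Um Up) (y : ℝ) :
    iteratedDeriv 2 U y = -m U y ^ 2 * U y := by
  by_cases hy : U y = 0
  · rw [h.iteratedDeriv_two_eq_zero hy, hy, mul_zero]
  · rw [h.sq_m, neg_neg, curvatureRatio, if_neg hy, div_mul_cancel₀ _ hy]

/-- At the zero of `U` the quotient `U'' / U` tends to `U''' / U'`, as a quotient of slopes. -/
theorem H1.continuous_curvatureRatio (h : H1 U Um Up) : Continuous (curvatureRatio U) := by
  rw [continuous_iff_continuousAt]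
  intro y
  by_cases hy : U y = 0
  · rw [continuousAt_iff_punctured_nhds]
    have h1 := hasDerivAt_iff_tendsto_slope.1 (h.hasDerivAt_iteratedDeriv 2 y)
    have h2 := hasDerivAt_iff_tendsto_slope.1 (h.hasDerivAt y)
    have h3 := h1.div h2 (h.deriv_pos y).ne'
    rw [curvatureRatio, if_pos hy]
    refine h3.congr' ?_
    filter_upwards [self_mem_nhdsWithin] with x hx
    have hx' : U x ≠ 0 := fun h0 => hx (h.strictMono.injective (h0.trans hy.symm))
    have hxy : x - y ≠ 0 := sub_ne_zero.2 hx
    rw [Pi.div_apply, slope_def_field, slope_def_field, hy, h.iteratedDeriv_two_eq_zero hy,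
      curvatureRatio, if_neg hx', sub_zero, sub_zero, div_div_div_cancel_right₀ hxy]
  · have h1 : ContinuousAt (fun x => iteratedDeriv 2 U x / U x) y :=
      (h.continuous_iteratedDeriv 2).continuousAt.div h.smooth.continuous.continuousAt hy
    refine h1.congr ?_
    filter_upwards [h.smooth.continuous.continuousAt.eventually_ne hy] with x hx
    rw [curvatureRatio, if_neg hx]

theorem H1.continuous_m (h : H1 U Um Up) : Continuous (m U) :=
  h.continuous_curvatureRatio.neg.sqrt

theorem H1.hasDerivAt_m (h : H1 U Um Up) {y : ℝ} (hy : U y ≠ 0) :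
    HasDerivAt (m U) (deriv (m U) y) y := by
  refine DifferentiableAt.hasDerivAt ?_
  have h1 : DifferentiableAt ℝ (fun x => iteratedDeriv 2 U x / U x) y :=
    (h.hasDerivAt_iteratedDeriv 2 y).differentiableAt.div (h.hasDerivAt y).differentiableAt hy
  have h2 : DifferentiableAt ℝ (curvatureRatio U) y := by
    refine h1.congr_of_eventuallyEq ?_
    filter_upwards [h.smooth.continuous.continuousAt.eventually_ne hy] with x hx
    rw [curvatureRatio, if_neg hx]
  exact h2.neg.sqrt (by simpa using (h.ratio_neg y).ne)

theorem m_nonneg (y : ℝ) : 0 ≤ m U y := Real.sqrt_nonneg _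

theorem exists_m_le (h : H1 U Um Up) (h' : H2 U Um Up) : ∃ M, ∀ y, m U y ≤ M := by
  let f : ZeroAtInftyContinuousMap ℝ ℝ := ⟨⟨m U, h.continuous_m⟩, h'.tendsto_zero⟩
  obtain ⟨M, hM⟩ := f.isBounded_range.bddAbove
  exact ⟨M, fun y => hM ⟨y, rfl⟩⟩

theorem exists_abs_deriv_m_le (h' : H2 U Um Up) :
    ∃ C, 0 < C ∧ ∀ y, |deriv (m U) y| ≤ C * m U y := by
  simpa using h'.deriv_bound 1

theorem isMultiplier_m (h : H1 U Um Up) (h' : H2 U Um Up) :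
    IsMultiplier (fun y => (m U y : ℂ)) (fun y => ((deriv (m U) y : ℝ) : ℂ)) := by
  obtain ⟨M, hM⟩ := exists_m_le h h'
  obtain ⟨C, hC0, hC⟩ := exists_abs_deriv_m_le h'
  refine ⟨Complex.continuous_ofReal.comp h.continuous_m, ⟨M, fun y => ?_⟩,
    (Complex.measurable_ofReal.comp (measurable_deriv _)).aestronglyMeasurable,
    ⟨C * M, fun y => ?_⟩, ?_⟩
  · rw [Complex.norm_real, Real.norm_of_nonneg (m_nonneg y)]
    exact hM y
  · rw [Complex.norm_real, Real.norm_eq_abs]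
    exact (hC y).trans (by gcongr; exact hM y)
  · obtain ⟨y₀, h0⟩ := h.exists_ne_zero
    exact ⟨y₀, fun y hy => (h.hasDerivAt_m (h0 y hy)).ofReal_comp⟩

theorem memLp_two_m (h' : H2 U Um Up) : MemLp (fun y => (m U y : ℂ)) 2 (volume : Measure ℝ) :=
  h'.memLp_two.ofReal

theorem memLp_two_deriv_m (h' : H2 U Um Up) :
    MemLp (fun y => ((deriv (m U) y : ℝ) : ℂ)) 2 (volume : Measure ℝ) := by
  obtain ⟨C, hC0, hC⟩ := exists_abs_deriv_m_le h'
  refine MemLp.of_le_mul (memLp_two_m h') (c := C)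
    (Complex.measurable_ofReal.comp (measurable_deriv _)).aestronglyMeasurable
    (.of_forall fun y => ?_)
  rw [Complex.norm_real, Complex.norm_real, Real.norm_eq_abs, Real.norm_of_nonneg (m_nonneg y)]
  exact hC y

/-- By the mean value theorem `U'` is bounded at some point of every unit interval, and
`U'' = -m² U` is bounded. -/
theorem exists_deriv_le (h : H1 U Um Up) (h' : H2 U Um Up) : ∃ B, ∀ y, deriv U y ≤ B := by
  obtain ⟨M, hM⟩ := exists_m_le h h'
  set B := max |Um| |Up|
  have hM0 : 0 ≤ M := (m_nonneg 0).trans (hM 0)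
  refine ⟨2 * B + M ^ 2 * B, fun y => ?_⟩
  obtain ⟨c, hc, hcd⟩ := exists_deriv_eq_slope U (lt_add_one y) h.smooth.continuous.continuousOn
    (fun x _ => (h.hasDerivAt x).differentiableAt.differentiableWithinAt)
  have h1 : ∀ x, HasDerivAt (deriv U) (iteratedDeriv 2 U x) x := fun x => by
    simpa using h.hasDerivAt_iteratedDeriv 1 x
  have h2 := Convex.norm_image_sub_le_of_norm_hasDerivWithin_le (C := M ^ 2 * B)
    (fun x _ => (h1 x).hasDerivWithinAt) (fun x _ => by
      rw [h.iteratedDeriv_two_eq, norm_mul, norm_neg, norm_pow, Real.norm_of_nonneg (m_nonneg x)]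
      gcongr
      · exact m_nonneg x
      · exact hM x
      · exact h.abs_le x) convex_univ (mem_univ c) (mem_univ y)
  have h3 : ‖y - c‖ ≤ 1 := by
    rw [Real.norm_eq_abs, abs_le]; constructor <;> linarith [hc.1, hc.2]
  have h4 : M ^ 2 * B * ‖y - c‖ ≤ M ^ 2 * B :=
    mul_le_of_le_one_right (by positivity) h3
  have h5 := (le_abs_self _).trans (h2.trans h4)
  have h6 : deriv U c ≤ 2 * B := by
    rw [hcd, add_sub_cancel_left, div_one]
    linarith [(abs_le.1 (h.abs_le (y + 1))).2, (abs_le.1 (h.abs_le y)).1]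
  linarith

theorem isMultiplier_U (h : H1 U Um Up) (h' : H2 U Um Up) :
    IsMultiplier (fun y => (U y : ℂ)) (fun y => ((deriv U y : ℝ) : ℂ)) := by
  obtain ⟨B, hB⟩ := exists_deriv_le h h'
  refine ⟨Complex.continuous_ofReal.comp h.smooth.continuous, ⟨max |Um| |Up|, fun y => ?_⟩,
    (Complex.measurable_ofReal.comp (measurable_deriv _)).aestronglyMeasurable,
    ⟨B, fun y => ?_⟩, 0, fun y _ => (h.hasDerivAt y).ofReal_comp⟩
  · rw [Complex.norm_real]
    exact h.abs_le y
  · rw [Complex.norm_real, Real.norm_of_nonneg (h.deriv_pos y).le]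
    exact hB y

end

/-! ### The Birman–Schwinger operators -/

section

variable {E : Type} [NormedAddCommGroup E] [InnerProductSpace ℂ E] [CompleteSpace E]

theorem conjugate_le_conjugate {a b c : E →L[ℂ] E} (h : a ≤ b) (hc : IsSelfAdjoint c) :
    c * a * c ≤ c * b * c :=
  hc.conjugate_le_conjugate h

theorem conjStarAlgEquiv_nonneg (e : E ≃ₗᵢ[ℂ] E) {a : E →L[ℂ] E} (ha : 0 ≤ a) :
    0 ≤ e.conjStarAlgEquiv a :=
  map_nonneg _ ha

theorem norm_le_norm_of_nonneg_of_le {a b : E →L[ℂ] E} (ha : 0 ≤ a) (h : a ≤ b) : ‖a‖ ≤ ‖b‖ :=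
  CStarAlgebra.norm_le_norm_of_nonneg_of_le ha h

/-- A nonzero nonnegative operator has its norm in its spectrum. -/
theorem norm_ne_one_of_isUnit_one_sub {a : E →L[ℂ] E} (ha : 0 ≤ a) (h : IsUnit (1 - a)) :
    ‖a‖ ≠ 1 := by
  intro h1
  have : Nontrivial (E →L[ℂ] E) := ⟨a, 0, fun h0 => by simp [h0] at h1⟩
  have h2 := CStarAlgebra.norm_mem_spectrum_of_nonneg ha
  rw [h1, spectrum.mem_iff, map_one] at h2
  exact h2 h

end

theorem fourierMultiplier_eq (p : ℝ → ℂ) :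
    fourierMultiplier p = (Lp.fourierTransformₗᵢ ℝ ℂ).symm.conjStarAlgEquiv (mulOp p) := rfl

theorem norm_fourierMultiplier_le {p : ℝ → ℂ} {C : ℝ} (hC0 : 0 ≤ C) (hC : ∀ ξ, ‖p ξ‖ ≤ C) :
    ‖fourierMultiplier p‖ ≤ C := by
  refine ContinuousLinearMap.opNorm_le_bound _ hC0 fun u => ?_
  have h : ‖fourierMultiplier p u‖ = ‖mulOp p (Lp.fourierTransformₗᵢ ℝ ℂ u)‖ :=
    (Lp.fourierTransformₗᵢ ℝ ℂ).symm.norm_map _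
  rw [h]
  refine (ContinuousLinearMap.le_of_opNorm_le _ (norm_mulOp_le hC0 hC) _).trans_eq ?_
  rw [LinearIsometryEquiv.norm_map]

theorem fourierMultiplier_sub {p q : ℝ → ℂ} (hp : MemLp p ∞ (volume : Measure ℝ))
    (hq : MemLp q ∞ (volume : Measure ℝ)) :
    fourierMultiplier (fun ξ => p ξ - q ξ) = fourierMultiplier p - fourierMultiplier q := by
  simp only [fourierMultiplier_eq, mulOp_sub hp hq, map_sub]

theorem fourierMultiplier_nonneg {p : ℝ → ℝ} (hp : ∀ ξ, 0 ≤ p ξ) :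
    0 ≤ fourierMultiplier fun ξ => (p ξ : ℂ) :=
  conjStarAlgEquiv_nonneg _ (mulOp_nonneg hp)

theorem laplaceResolvent_nonneg {s : ℝ} (hs : 0 < s) : 0 ≤ laplaceResolvent s :=
  fourierMultiplier_nonneg fun ξ => (resolventSymbol_pos hs ξ).le

theorem norm_laplaceResolvent_le {s : ℝ} (hs : 0 < s) : ‖laplaceResolvent s‖ ≤ s⁻¹ :=
  norm_fourierMultiplier_le (by positivity) fun ξ => by
    rw [Complex.norm_real, Real.norm_of_nonneg (resolventSymbol_pos hs ξ).le]
    exact resolventSymbol_le hs ξ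

theorem laplaceResolvent_anti {s t : ℝ} (hs : 0 < s) (hst : s ≤ t) :
    laplaceResolvent t ≤ laplaceResolvent s := by
  have ht := hs.trans_le hst
  rw [← sub_nonneg, laplaceResolvent, laplaceResolvent,
    ← fourierMultiplier_sub (memLp_top_resolventSymbol hs) (memLp_top_resolventSymbol ht)]
  simpa using fourierMultiplier_nonneg (p := fun ξ => resolventSymbol s ξ - resolventSymbol t ξ)
    fun ξ => sub_nonneg.2 (inv_anti₀ (by positivity) (by gcongr))

theorem norm_laplaceResolvent_sub_le {s t : ℝ} (hs : 1 ≤ s) (ht : 1 ≤ t) :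
    ‖laplaceResolvent s - laplaceResolvent t‖ ≤ |s - t| := by
  have hs0 : 0 < s := by linarith
  have ht0 : 0 < t := by linarith
  rw [laplaceResolvent, laplaceResolvent,
    ← fourierMultiplier_sub (memLp_top_resolventSymbol hs0) (memLp_top_resolventSymbol ht0)]
  refine norm_fourierMultiplier_le (abs_nonneg _) fun ξ => ?_
  rw [← Complex.ofReal_sub, Complex.norm_real, Real.norm_eq_abs, resolventSymbol, resolventSymbol]
  have h1 : 1 ≤ (2 * Real.pi * ξ) ^ 2 + s := by nlinarith [sq_nonneg (2 * Real.pi * ξ)]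
  have h2 : 1 ≤ (2 * Real.pi * ξ) ^ 2 + t := by nlinarith [sq_nonneg (2 * Real.pi * ξ)]
  rw [inv_sub_inv (by positivity) (by positivity), abs_div, add_sub_add_left_eq_sub, abs_sub_comm]
  refine div_le_self (abs_nonneg _) ?_
  rw [abs_of_nonneg (by positivity)]
  exact one_le_mul_of_one_le_of_one_le h1 h2

theorem hasComm_laplaceResolvent {s : ℝ} (hs : 0 < s) : HasComm (laplaceResolvent s) 0 :=
  fun u v h => by
    rw [_root_.zero_apply, add_zero]
    exact h.fourierMultiplier (memLp_top_resolventSymbol hs)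

theorem IsMultiplier.hasComm {φ φ' : ℝ → ℂ} (h : IsMultiplier φ φ') :
    HasComm (mulOp φ) (mulOp φ') :=
  fun u v hu => by
    rw [add_comm]
    exact hu.mulOp h

/-- The Birman–Schwinger operator `m (s - ∂²)⁻¹ m`. -/
def birmanSchwinger (U : ℝ → ℝ) (s : ℝ) : L2 →L[ℂ] L2 :=
  mulOp (fun y => (m U y : ℂ)) * laplaceResolvent s * mulOp (fun y => (m U y : ℂ))

/-- The commutator `[∂, m (s - ∂²)⁻¹ m]`. -/
def birmanSchwingerComm (U : ℝ → ℝ) (s : ℝ) : L2 →L[ℂ] L2 :=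
  mulOp (fun y => (m U y : ℂ)) * laplaceResolvent s *
      mulOp (fun y => ((deriv (m U) y : ℝ) : ℂ)) +
    mulOp (fun y => ((deriv (m U) y : ℝ) : ℂ)) * laplaceResolvent s *
      mulOp (fun y => (m U y : ℂ))

theorem laplaceInv_eq (α : ℤ) (hα : α ≠ 0) : laplaceInv α = -laplaceResolvent ((α : ℝ) ^ 2) := by
  have hs : 0 < (α : ℝ) ^ 2 := by positivity
  have h := fourierMultiplier_sub (p := fun _ => 0) (memLp_top_const 0)
    (memLp_top_resolventSymbol hs)
  have h0 : fourierMultiplier (fun _ => 0) = 0 := by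
    rw [fourierMultiplier_eq, mulOp_const, zero_smul, map_zero]
  rw [h0, zero_sub] at h
  rw [laplaceResolvent, ← h, laplaceInv]
  congr 1
  ext ξ
  simp [resolventSymbol]

theorem Sig_eq (U : ℝ → ℝ) (α : ℤ) (hα : α ≠ 0) :
    Sig U α = 1 - birmanSchwinger U ((α : ℝ) ^ 2) := by
  rw [Sig, laplaceInv_eq α hα, birmanSchwinger, mul_neg, neg_mul, sub_eq_add_neg]

theorem birmanSchwinger_nonneg (U : ℝ → ℝ) {s : ℝ} (hs : 0 < s) : 0 ≤ birmanSchwinger U s := by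
  have h := conjugate_le_conjugate (laplaceResolvent_nonneg hs) (isSelfAdjoint_mulOp_ofReal (m U))
  rwa [mul_zero, zero_mul] at h

theorem norm_birmanSchwinger_le_of_le (U : ℝ → ℝ) {s t : ℝ} (hs : 0 < s) (hst : s ≤ t) :
    ‖birmanSchwinger U t‖ ≤ ‖birmanSchwinger U s‖ :=
  norm_le_norm_of_nonneg_of_le (birmanSchwinger_nonneg U (hs.trans_le hst))
    (conjugate_le_conjugate (laplaceResolvent_anti hs hst) (isSelfAdjoint_mulOp_ofReal (m U)))

section

variable {U : ℝ → ℝ} {Um Up : ℝ}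

theorem exists_norm_birmanSchwinger_le (h : H1 U Um Up) (h' : H2 U Um Up) :
    ∃ C, 0 ≤ C ∧ (∀ s, 0 < s → ‖birmanSchwinger U s‖ ≤ C / s) ∧
      (∀ s, 0 < s → ‖birmanSchwingerComm U s‖ ≤ C / s) ∧
      ∀ s t, 1 ≤ s → 1 ≤ t → ‖birmanSchwinger U s - birmanSchwinger U t‖ ≤ C * |s - t| := by
  obtain ⟨M, hM⟩ := (isMultiplier_m h h').bounded
  obtain ⟨M', hM'⟩ := (isMultiplier_m h h').bounded_deriv
  have hM0 : 0 ≤ M := (norm_nonneg _).trans (hM 0)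
  have hM'0 : 0 ≤ M' := (norm_nonneg _).trans (hM' 0)
  have hm := norm_mulOp_le hM0 hM
  have hm' := norm_mulOp_le hM'0 hM'
  have key : ∀ {A B : L2 →L[ℂ] L2} {a b c : ℝ} (G : L2 →L[ℂ] L2), 0 ≤ a → 0 ≤ c → ‖A‖ ≤ a →
      ‖B‖ ≤ b → ‖G‖ ≤ c → ‖A * G * B‖ ≤ a * c * b := fun G ha hc hA hB hG =>
    (norm_mul_le _ _).trans (mul_le_mul ((norm_mul_le _ _).trans (by gcongr)) hB
      (norm_nonneg _) (by positivity))
  have e1 : 0 ≤ M ^ 2 := by positivity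
  have e2 : 0 ≤ M * M' := by positivity
  refine ⟨M ^ 2 + 2 * (M * M'), by positivity, fun s hs => ?_, fun s hs => ?_,
    fun s t hs ht => ?_⟩
  · refine (key _ hM0 (by positivity) hm hm (norm_laplaceResolvent_le hs)).trans ?_
    rw [div_eq_mul_inv]
    calc M * s⁻¹ * M = M ^ 2 * s⁻¹ := by ring
      _ ≤ _ := by gcongr; linarith
  · refine (norm_add_le _ _).trans ((add_le_add
      (key _ hM0 (by positivity) hm hm' (norm_laplaceResolvent_le hs))
      (key _ hM'0 (by positivity) hm' hm (norm_laplaceResolvent_le hs))).trans ?_)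
    rw [div_eq_mul_inv]
    calc M * s⁻¹ * M' + M' * s⁻¹ * M = 2 * (M * M') * s⁻¹ := by ring
      _ ≤ _ := by gcongr; linarith
  · rw [birmanSchwinger, birmanSchwinger, ← sub_mul, ← mul_sub]
    refine (key _ hM0 (abs_nonneg _) hm hm (norm_laplaceResolvent_sub_le hs ht)).trans ?_
    calc M * |s - t| * M = M ^ 2 * |s - t| := by ring
      _ ≤ _ := by gcongr; linarith

theorem isCompactOperator_birmanSchwinger (h : H1 U Um Up) (h' : H2 U Um Up) {s : ℝ}
    (hs : 1 ≤ s) : IsCompactOperator (birmanSchwinger U s) :=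
  (isCompactOperator_mulOp_fourierMultiplier (isMultiplier_m h h').memLp (memLp_two_m h')
    (memLp_top_resolventSymbol (by linarith)) (memLp_two_resolventSymbol hs)).comp_clm _

theorem isCompactOperator_birmanSchwingerComm (h : H1 U Um Up) (h' : H2 U Um Up) {s : ℝ}
    (hs : 1 ≤ s) : IsCompactOperator (birmanSchwingerComm U s) :=
  ((isCompactOperator_mulOp_fourierMultiplier (isMultiplier_m h h').memLp (memLp_two_m h')
    (memLp_top_resolventSymbol (by linarith)) (memLp_two_resolventSymbol hs)).comp_clm _).add
  ((isCompactOperator_mulOp_fourierMultiplier (isMultiplier_m h h').memLp_deriv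
    (memLp_two_deriv_m h')
    (memLp_top_resolventSymbol (by linarith)) (memLp_two_resolventSymbol hs)).comp_clm _)

theorem isSelfAdjoint_birmanSchwingerComm (U : ℝ → ℝ) {s : ℝ} (hs : 0 < s) :
    IsSelfAdjoint (birmanSchwingerComm U s) := by
  have hG : IsSelfAdjoint (laplaceResolvent s) :=
    (ContinuousLinearMap.nonneg_iff_isPositive _ |>.1 (laplaceResolvent_nonneg hs)).isSelfAdjoint
  rw [IsSelfAdjoint, birmanSchwingerComm, star_add, star_mul, star_mul, star_mul, star_mul,
    hG.star_eq, (isSelfAdjoint_mulOp_ofReal (m U)).star_eq,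
    (isSelfAdjoint_mulOp_ofReal (deriv (m U))).star_eq, add_comm, mul_assoc, mul_assoc]

theorem hasComm_birmanSchwinger (h : H1 U Um Up) (h' : H2 U Um Up) {s : ℝ} (hs : 0 < s) :
    HasComm (birmanSchwinger U s) (birmanSchwingerComm U s) := by
  have hm := (isMultiplier_m h h').hasComm
  have := (hm.mul (hasComm_laplaceResolvent hs)).mul hm
  rwa [mul_zero, zero_add] at this

theorem isDeriv₂_weakDeriv₂ (u : weakDeriv₂.domain) : IsDeriv₂ u (weakDeriv₂ u) :=
  l2Realization_spec _ u

theorem IsDeriv₂.unique {u v w : L2} (h : IsDeriv₂ u v) (h' : IsDeriv₂ u w) : v = w :=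
  toDistr_injective (h.trans h'.symm)

/-- The Birman–Schwinger principle: if `-s` is in the resolvent set of `-∂² - m²` then `1` is in
the resolvent set of `m (s - ∂²)⁻¹ m`. -/
theorem isUnit_one_sub_birmanSchwinger (h : H1 U Um Up) (h' : H2 U Um Up) {s : ℝ} (hs : 0 < s)
    (hr : ((-s : ℝ) : ℂ) ∈ resolventSet (schrodinger U)) : IsUnit (1 - birmanSchwinger U s) := by
  obtain ⟨R, hR1, hR2⟩ := hr
  set G := laplaceResolvent s with hG
  set M := mulOp (fun y => (m U y : ℂ)) with hM
  have hmm : mulOp (fun y => ((m U y ^ 2 : ℝ) : ℂ)) = M * M := by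
    rw [hM, mulOp_mul (isMultiplier_m h h').memLp (isMultiplier_m h h').memLp]
    congr 1
    ext y
    push_cast
    ring
  have hL : ∀ u : (schrodinger U).domain, ∃ v, IsDeriv₂ u v ∧
      schrodinger U u = -((M * M) u) - v := fun u => by
    have hu : (u : L2) ∈ weakDeriv₂.domain := u.2
    refine ⟨weakDeriv₂ ⟨u, hu⟩, isDeriv₂_weakDeriv₂ _, ?_⟩
    rw [← hmm, sub_eq_add_neg]
    rfl
  -- The two forms of the second resolvent identity for `-∂²` and `-∂² - m²`.
  have e1 : G * (M * M) * R - G = R := by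
    ext1 f
    obtain ⟨hd, hf⟩ := hR1 f
    obtain ⟨v, hv, hLv⟩ := hL ⟨R f, hd⟩
    rw [hLv] at hf
    have h1 := hv.laplaceResolvent_eq hs
    rw [_root_.sub_apply]
    change G ((M * M) (R f)) - G f = R f
    rw [← map_sub]
    refine Eq.trans (congrArg G ?_) h1
    rw [Complex.ofReal_neg] at hf
    refine (congrArg (_ - ·) hf.symm).trans ?_
    module
  have e2 : R * (M * M) * G - G = R := by
    ext1 f
    have hd2 := isDeriv₂_laplaceResolvent hs f
    have hd : G f ∈ (schrodinger U).domain := by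
      change G f ∈ weakDeriv₂.domain
      exact (mem_l2Realization_domain _ _).2 ⟨_, hd2⟩
    have h1 := hR2 ⟨G f, hd⟩
    obtain ⟨v, hv, hLv⟩ := hL ⟨G f, hd⟩
    rw [hLv, hv.unique hd2] at h1
    rw [_root_.sub_apply]
    change R ((M * M) (G f)) - G f = R f
    rw [sub_eq_iff_eq_add, ← sub_eq_iff_eq_add', ← map_sub]
    refine Eq.trans (congrArg R ?_) h1
    rw [← hG, Complex.ofReal_neg]
    module
  -- They say that `1 - m R m` is a two-sided inverse of `1 - m (s - ∂²)⁻¹ m`.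
  have f1 : (1 - birmanSchwinger U s) * (1 - M * R * M) = 1 := by
    have : birmanSchwinger U s * (M * R * M) = M * R * M + birmanSchwinger U s := by
      change M * G * M * (M * R * M) = M * R * M + M * G * M
      calc M * G * M * (M * R * M) = M * (G * (M * M) * R - G) * M + M * G * M := by noncomm_ring
        _ = _ := by rw [e1]
    rw [mul_sub, sub_mul, sub_mul, this]
    noncomm_ring
  have f2 : (1 - M * R * M) * (1 - birmanSchwinger U s) = 1 := by
    have : (M * R * M) * birmanSchwinger U s = M * R * M + birmanSchwinger U s := by
      change M * R * M * (M * G * M) = M * R * M + M * G * M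
      calc M * R * M * (M * G * M) = M * (R * (M * M) * G - G) * M + M * G * M := by noncomm_ring
        _ = _ := by rw [e2]
    rw [mul_sub, sub_mul, sub_mul, this]
    noncomm_ring
  exact ⟨⟨_, _, f1, f2⟩, rfl⟩

/-- `m (1 - ∂²)⁻¹ m` is a strict contraction: the norm of `m (s - ∂²)⁻¹ m` depends continuously
on `s`, tends to `0` at infinity, and avoids the value `1` for `s ≥ 1`. -/
theorem norm_birmanSchwinger_one_lt (h : H1 U Um Up) (h' : H2 U Um Up) (h3 : H3 U) :
    ‖birmanSchwinger U 1‖ < 1 := by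
  obtain ⟨C, hC0, hC, -, hC'⟩ := exists_norm_birmanSchwinger_le h h'
  have hne : ∀ s, 1 ≤ s → ‖birmanSchwinger U s‖ ≠ 1 := fun s hs => by
    have hs0 : 0 < s := by linarith
    refine norm_ne_one_of_isUnit_one_sub (birmanSchwinger_nonneg U hs0)
      (isUnit_one_sub_birmanSchwinger h h' hs0 ?_)
    obtain ⟨l, hl, hl1⟩ := h3
    by_contra hr
    have := hl.1 hr
    linarith
  by_contra! h1
  have hcont : ContinuousOn (fun s => ‖birmanSchwinger U s‖) (Ici 1) := by
    refine ContinuousOn.norm ?_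
    refine LipschitzOnWith.continuousOn (K := C.toNNReal) (LipschitzOnWith.of_dist_le_mul
      fun s hs t ht => ?_)
    rw [dist_eq_norm, Real.coe_toNNReal C hC0]
    exact hC' s t hs ht
  have hlarge : ‖birmanSchwinger U (C + 1)‖ ≤ 1 :=
    (hC _ (by linarith)).trans ((div_le_one (by linarith)).2 (by linarith))
  obtain ⟨s, hs, hs1⟩ := intermediate_value_Icc' (by linarith : (1 : ℝ) ≤ C + 1)
    (hcont.mono Icc_subset_Ici_self) ⟨hlarge, h1⟩
  exact hne s hs.1 hs1

end

/-! ### The operators `H` and their commutators -/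

/-- With `A = i ∂` one has `[B, A] = -i [∂, B]`. -/
theorem HasComm.isCommutator {B D : L2 →L[ℂ] L2} (h : HasComm B D) :
    IsCommutator B conjOp (-Complex.I • D) := by
  intro u
  have hu : (u : L2) ∈ weakDeriv.domain := u.2
  set v := weakDeriv ⟨u, hu⟩ with hv
  have h1 : IsDeriv (u : L2) v := l2Realization_spec _ (⟨u, hu⟩ : weakDeriv.domain)
  have h2 := h _ _ h1
  have hd : B u ∈ weakDeriv.domain := (mem_l2Realization_domain _ _).2 ⟨_, h2⟩
  refine ⟨hd, ?_⟩
  have h3 : weakDeriv ⟨B u, hd⟩ = B v + D u :=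
    IsDeriv.unique (l2Realization_spec _ (⟨B u, hd⟩ : weakDeriv.domain)) h2
  change -Complex.I • D u = B (Complex.I • v) - Complex.I • weakDeriv ⟨B u, hd⟩
  rw [h3, map_smul]
  module

section

variable {E : Type} [NormedAddCommGroup E] [InnerProductSpace ℂ E]

theorem conj_sub_eq (s V : E →L[ℂ] E) : s * V * s - V = (s - 1) * V * s + V * (s - 1) := by
  noncomm_ring

theorem norm_conj_sub_le {s V : E →L[ℂ] E} {t v : ℝ} (h1 : ‖s‖ ≤ 1) (ht : ‖s - 1‖ ≤ t)
    (hv : ‖V‖ ≤ v) : ‖s * V * s - V‖ ≤ 2 * v * t := by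
  have ht0 := (norm_nonneg _).trans ht
  have hv0 := (norm_nonneg _).trans hv
  rw [conj_sub_eq]
  calc ‖(s - 1) * V * s + V * (s - 1)‖ ≤ ‖s - 1‖ * ‖V‖ * ‖s‖ + ‖V‖ * ‖s - 1‖ :=
        (norm_add_le _ _).trans (add_le_add ((norm_mul_le _ _).trans
          (by gcongr; exact norm_mul_le _ _)) (norm_mul_le _ _))
    _ ≤ t * v * 1 + v * t := by gcongr
    _ = 2 * v * t := by ring

theorem isCompactOperator_conj_sub {s : E →L[ℂ] E} (h : IsCompactOperator (s - 1 : E →L[ℂ] E))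
    (V : E →L[ℂ] E) : IsCompactOperator (s * V * s - V) := by
  rw [conj_sub_eq]
  exact IsCompactOperator.add ((h.comp_clm V).comp_clm s) (h.clm_comp V)

end

section

variable {U : ℝ → ℝ} {Um Up : ℝ}

/-- The operator `H` is self-adjoint, and both `H - U` and `[∂, H] - U'` are compact, with norms
`O(α⁻²)`; the decay in `α` is what makes it possible to choose one compact operator for all `α`. -/
theorem exists_hasComm_H (h : H1 U Um Up) (h' : H2 U Um Up) (h3 : H3 U) :
    ∃ c : ℝ, 0 ≤ c ∧ ∀ α : ℤ, α ≠ 0 → IsSelfAdjoint (H U α) ∧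
      IsCompactOperator (H U α - mulOp fun y => (U y : ℂ)) ∧
      ‖H U α - mulOp fun y => (U y : ℂ)‖ ≤ c / (α : ℝ) ^ 2 ∧
      ∃ R : L2 →L[ℂ] L2, HasComm (H U α) (mulOp (fun y => ((deriv U y : ℝ) : ℂ)) + R) ∧
        IsSelfAdjoint R ∧ IsCompactOperator R ∧ ‖R‖ ≤ c / (α : ℝ) ^ 2 := by
  obtain ⟨C, hC0, hC, hC', -⟩ := exists_norm_birmanSchwinger_le h h'
  have hq := norm_birmanSchwinger_one_lt h h' h3
  obtain ⟨q, hq1, hq2⟩ := exists_between hq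
  obtain ⟨C₁, hC₁, hS⟩ := HasComm.exists_opSqrt ((norm_nonneg _).trans_lt hq1) hq2
  set V := mulOp fun y => (U y : ℂ) with hV
  set V' := mulOp fun y => ((deriv U y : ℝ) : ℂ) with hV'
  have hVc : HasComm V V' := (isMultiplier_U h h').hasComm
  have hVs : IsSelfAdjoint V := isSelfAdjoint_mulOp_ofReal U
  have hVs' : IsSelfAdjoint V' := isSelfAdjoint_mulOp_ofReal (deriv U)
  clear_value V V'
  refine ⟨2 * (‖V‖ + ‖V'‖) * C + 2 * ‖V‖ * (C₁ * C), by positivity, fun α hα => ?_⟩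
  have hs0 : 0 < (α : ℝ) ^ 2 := by positivity
  have hs1 : 1 ≤ (α : ℝ) ^ 2 := by
    have h1 : (1 : ℤ) ≤ α ^ 2 := by
      have : 0 < α ^ 2 := by positivity
      omega
    exact_mod_cast h1
  set s := (α : ℝ) ^ 2 with hs
  set T := birmanSchwinger U s with hT
  have hT0 : 0 ≤ T := birmanSchwinger_nonneg U hs0
  have hTq : ‖T‖ ≤ q := (norm_birmanSchwinger_le_of_le U one_pos hs1).trans hq1.le
  have hT1 : ‖T‖ < 1 := hTq.trans_lt hq2
  obtain ⟨D, hD, hDs, hDc, hDn⟩ := hS T _ hT0 hTq (hasComm_birmanSchwinger h h' hs0)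
    (isSelfAdjoint_birmanSchwingerComm U hs0) (isCompactOperator_birmanSchwingerComm h h' hs1)
  have hH : H U α = opSqrt (1 - T) * V * opSqrt (1 - T) := by
    rw [H, S, Sig_eq U α hα, hV]
  have hSs : IsSelfAdjoint (opSqrt (1 - T)) := isSelfAdjoint_opSqrt _
  have hSn : ‖opSqrt (1 - T)‖ ≤ 1 := norm_opSqrt_le hT0 hT1
  have hSn' : ‖opSqrt (1 - T) - 1‖ ≤ C / s := (norm_opSqrt_sub_one_le hT0 hT1).trans (hC s hs0)
  have hSc : IsCompactOperator (opSqrt (1 - T) - 1 : L2 →L[ℂ] L2) :=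
    isCompactOperator_opSqrt_sub_one hT0 hT1 (isCompactOperator_birmanSchwinger h h' hs1)
  rw [hH]
  clear hH
  generalize opSqrt (1 - T) = Q at *
  have hDn' : ‖D‖ ≤ C₁ * C / s := hDn.trans (by
    rw [mul_div_assoc]; gcongr; exact hC' s hs0)
  have hQD : ‖Q * V * D‖ ≤ ‖V‖ * (C₁ * C / s) := by
    calc ‖Q * V * D‖ ≤ ‖Q‖ * ‖V‖ * ‖D‖ := (norm_mul_le _ _).trans (by gcongr; exact norm_mul_le _ _)
      _ ≤ 1 * ‖V‖ * (C₁ * C / s) := by gcongr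
      _ = _ := by ring
  have hQD' : ‖D * V * Q‖ ≤ ‖V‖ * (C₁ * C / s) := by
    calc ‖D * V * Q‖ ≤ ‖D‖ * ‖V‖ * ‖Q‖ := (norm_mul_le _ _).trans (by gcongr; exact norm_mul_le _ _)
      _ ≤ (C₁ * C / s) * ‖V‖ * 1 := by gcongr
      _ = _ := by ring
  refine ⟨?_, isCompactOperator_conj_sub hSc V,
    (norm_conj_sub_le hSn hSn' le_rfl).trans ?_,
    (Q * V * D + D * V * Q) + (Q * V' * Q - V'), ?_, ?_,
    (((hDc.clm_comp (Q * V)).add ((hDc.comp_clm V).comp_clm Q))).add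
      (isCompactOperator_conj_sub hSc V'), ?_⟩
  · rw [IsSelfAdjoint, star_mul, star_mul, hSs.star_eq, hVs.star_eq, mul_assoc]
  · rw [← mul_div_assoc]
    gcongr
    have : 0 ≤ 2 * ‖V'‖ * C + 2 * ‖V‖ * (C₁ * C) := by positivity
    linarith
  · have h1 := (hD.mul hVc).mul hD
    convert h1 using 1
    noncomm_ring
  · refine IsSelfAdjoint.add ?_ (IsSelfAdjoint.sub ?_ hVs')
    · rw [IsSelfAdjoint, star_add, star_mul, star_mul, star_mul, star_mul, hSs.star_eq,
        hVs.star_eq, hDs.star_eq, add_comm, mul_assoc, mul_assoc]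
    · rw [IsSelfAdjoint, star_mul, star_mul, hSs.star_eq, hVs'.star_eq, mul_assoc]
  · calc ‖Q * V * D + D * V * Q + (Q * V' * Q - V')‖
        ≤ ‖V‖ * (C₁ * C / s) + ‖V‖ * (C₁ * C / s) + 2 * ‖V'‖ * (C / s) :=
          (norm_add_le _ _).trans (add_le_add ((norm_add_le _ _).trans (add_le_add hQD hQD'))
            (norm_conj_sub_le hSn hSn' le_rfl))
      _ = (2 * ‖V'‖ * C + 2 * ‖V‖ * (C₁ * C)) / s := by ring
      _ ≤ _ := by
        gcongr
        exact le_add_of_nonneg_left (norm_nonneg V)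

end

/-! ### The localized velocity gradient -/

section

variable {U : ℝ → ℝ} {Um Up : ℝ}

theorem H1.contDiffAt_F (h : H1 U Um Up) {u : ℝ} (hu : u ∈ Ioo Um Up) :
    ContDiffAt ℝ ∞ (F U) u := by
  rw [← h.range_eq] at hu
  obtain ⟨y, rfl⟩ := hu
  have hs : ContDiffAt ℝ ∞ U y := h.smooth.contDiffAt
  have hd := (h.hasDerivAt y).hasFDerivAt_equiv (h.deriv_pos y).ne'
  have hn : (∞ : WithTop ℕ∞) ≠ 0 := by simp
  have hg := hs.to_localInverse hd hn
  have hU' : ContDiff ℝ ∞ (deriv U) := (contDiff_infty_iff_deriv.1 h.smooth).2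
  refine (hU'.contDiffAt.comp (U y) hg).congr_of_eventuallyEq ?_
  filter_upwards [(hs.hasStrictFDerivAt' hd hn).eventually_right_inverse] with u hu
  change F U u = deriv U (hs.localInverse hd hn u)
  rw [← F_apply h.deriv_pos (hs.localInverse hd hn u)]
  congr 1
  exact hu.symm

theorem H1.F_pos (h : H1 U Um Up) (u : ℝ) : 0 < F U u := h.deriv_pos _

/-- There is a smooth function `f` of compact support in `]U₋, U₊[` that coincides with
`F` on a given compact interval and is at most `F`. -/
theorem H1.exists_localized_F (h : H1 U Um Up) {a b : ℝ} (hab : a ≤ b)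
    (hI : Icc a b ⊆ Ioo Um Up) :
    ∃ f : ℝ → ℝ, ContDiff ℝ ∞ f ∧ HasCompactSupport f ∧ (∀ u ∈ Icc a b, f u = F U u) ∧
      ∀ y, f (U y) ≤ deriv U y := by
  have ha := hI (left_mem_Icc.2 hab)
  have hb := hI (right_mem_Icc.2 hab)
  obtain ⟨δ, hδ0, hδ⟩ := exists_between (lt_min (sub_pos.2 ha.1) (sub_pos.2 hb.2))
  rw [lt_min_iff] at hδ
  -- A bump equal to `1` on `[a, b]`, supported in `[a - δ, b + δ]`; the inner radius is enlarged by
  -- `δ / 2` because it has to be positive also when `a = b`.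
  let χ : ContDiffBump ((a + b) / 2) := ⟨(b - a) / 2 + δ / 2, (b - a) / 2 + δ, by linarith,
    by linarith⟩
  have hχ : tsupport χ ⊆ Ioo Um Up := by
    rw [χ.tsupport_eq, Real.closedBall_eq_Icc]
    intro x hx
    change (a + b) / 2 - ((b - a) / 2 + δ) ≤ x ∧ x ≤ (a + b) / 2 + ((b - a) / 2 + δ) at hx
    constructor <;> linarith [hx.1, hx.2, hδ.1, hδ.2]
  refine ⟨fun u => χ u * F U u, ?_, χ.hasCompactSupport.mul_right, fun u hu => ?_, fun y => ?_⟩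
  · rw [contDiff_iff_contDiffAt]
    intro u
    by_cases hu : u ∈ tsupport χ
    · exact χ.contDiffAt.mul (h.contDiffAt_F (hχ hu))
    · refine (contDiffAt_const (c := 0)).congr_of_eventuallyEq ?_
      filter_upwards [notMem_tsupport_iff_eventuallyEq.1 hu] with x hx
      rw [hx, Pi.zero_apply, zero_mul]
  · have : χ u = 1 := by
      refine χ.one_of_mem_closedBall ?_
      rw [Real.closedBall_eq_Icc]
      change (a + b) / 2 - ((b - a) / 2 + δ / 2) ≤ u ∧ u ≤ (a + b) / 2 + ((b - a) / 2 + δ / 2)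
      constructor <;> linarith [hu.1, hu.2]
    change χ u * F U u = _
    rw [this, one_mul]
  · change χ (U y) * F U (U y) ≤ _
    rw [F_apply h.deriv_pos]
    exact mul_le_of_le_one_left (h.deriv_pos y).le χ.le_one

end

/-! ### The commutator estimate -/

section

variable {E : Type} [NormedAddCommGroup E] [InnerProductSpace ℂ E] [CompleteSpace E]

theorem le_tsum_of_nonneg {ι : Type} {P : ι → E →L[ℂ] E} (h0 : ∀ i, 0 ≤ P i) (hs : Summable P)
    (i : ι) : P i ≤ ∑' j, P j :=
  hs.le_tsum i fun j _ => h0 j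

/-- Compact self-adjoint operators of norm `O(α⁻²)` have a common compact lower bound, namely minus
the sum of their absolute values. -/
theorem exists_isCompactOperator_forall_le {Z : ℤ → E →L[ℂ] E} {c : ℝ}
    (hs : ∀ α ≠ 0, IsSelfAdjoint (Z α)) (hc : ∀ α ≠ 0, IsCompactOperator (Z α))
    (hn : ∀ α ≠ 0, ‖Z α‖ ≤ c / (α : ℝ) ^ 2) :
    ∃ K : E →L[ℂ] E, IsCompactOperator K ∧ ∀ α ≠ 0, K ≤ Z α := by
  have hP : ∀ α : ℤ, ∃ P : E →L[ℂ] E, 0 ≤ P ∧ IsCompactOperator P ∧ ‖P‖ ≤ c * (1 / (α : ℝ) ^ 2) ∧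
      (α ≠ 0 → -P ≤ Z α) := fun α => by
    by_cases hα : α = 0
    · exact ⟨0, le_rfl, isCompactOperator_zero, by simp [hα], fun h => (h hα).elim⟩
    · obtain ⟨P, h0, hPc, hPn, hPZ⟩ := exists_isCompactOperator_neg_le (hs α hα) (hc α hα)
      exact ⟨P, h0, hPc, by rw [mul_one_div]; exact hPn.trans (hn α hα), fun _ => hPZ⟩
  choose P h0 hPc hPn hPZ using hP
  have hsum : Summable P :=
    .of_norm_bounded ((Real.summable_one_div_int_pow.2 one_lt_two).mul_left c) hPn
  refine ⟨-∑' α, P α, (isCompactOperator_of_hasSum hPc hsum.hasSum).neg, fun α hα => ?_⟩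
  exact (neg_le_neg (le_tsum_of_nonneg h0 hsum α)).trans (hPZ α hα)

/-- Only the values of `f` on the support of `g` matter in `g(a) f(a) g(a)`. -/
theorem smul_sq_funCalc_le {f g : ℝ → ℝ} (hf : Continuous f) (hg : Continuous g) {θ : ℝ}
    (h : ∀ x, g x ≠ 0 → θ ≤ f x) (a : E →L[ℂ] E) :
    (θ : ℂ) • funCalc g a ^ 2 ≤ funCalc g a * funCalc f a * funCalc g a := by
  have h1 : (θ : ℂ) • funCalc g a ^ 2 = funCalc (fun x => θ * (g x * g x)) a := by
    rw [sq, funCalc_mul hg hg, Complex.coe_smul]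
    exact (cfc_const_mul θ (fun x => g x * g x) a).symm
  rw [h1, funCalc_mul hg hf, funCalc_mul (f := fun x => g x * f x) (hg.mul hf) hg]
  refine funCalc_mono (by fun_prop) (by fun_prop) a fun x => ?_
  by_cases hx : g x = 0
  · simp [hx]
  · nlinarith [h x hx, mul_self_nonneg (g x)]

end

end ShearFlow

end

theorem mainTheorem5 (U : ℝ → ℝ) (Um Up : ℝ) (h1 : ShearFlow.H1 U Um Up)
    (h2 : ShearFlow.H2 U Um Up) (h3 : ShearFlow.H3 U) :
    ∃ C : ℤ → (ShearFlow.L2 →L[ℂ] ShearFlow.L2),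
      (∀ α : ℤ, α ≠ 0 → ShearFlow.IsCommutator (ShearFlow.H U α) ShearFlow.conjOp (C α)) ∧
      ∀ a b : ℝ, a ≤ b → Set.Icc a b ⊆ Set.Ioo Um Up →
        ∃ θ : ℝ, IsLeast (ShearFlow.F U '' Set.Icc a b) θ ∧ 0 < θ ∧
          ∃ K : ShearFlow.L2 →L[ℂ] ShearFlow.L2, IsCompactOperator K ∧
            ∀ α : ℤ, α ≠ 0 → ∀ g : ℝ → ℝ, ContDiff ℝ ∞ g → (∀ x, 0 ≤ g x) →
              tsupport g ⊆ Set.Icc a b →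
              (θ : ℂ) • ShearFlow.funCalc g (ShearFlow.H U α) ^ 2
                  + ShearFlow.funCalc g (ShearFlow.H U α) * K * ShearFlow.funCalc g (ShearFlow.H U α)
                ≤ ShearFlow.funCalc g (ShearFlow.H U α) * (Complex.I • C α) * ShearFlow.funCalc g (ShearFlow.H U α) := by
  open ShearFlow in
  obtain ⟨c, hc0, hc⟩ := exists_hasComm_H h1 h2 h3
  choose! hHs hHc hHn R hR hRs hRc hRn using hc
  set V := mulOp fun y => (U y : ℂ) with hV
  set V' := mulOp fun y => ((deriv U y : ℝ) : ℂ) with hV'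
  -- Here `[∂, H] = U' + R α`, so that `i [H, A] = U' + R α`.
  refine ⟨fun α => -Complex.I • (V' + R α), fun α hα => (hR α hα).isCommutator,
    fun a b hab hI => ?_⟩
  have hFc : ContinuousOn (F U) (Icc a b) := fun u hu =>
    (h1.contDiffAt_F (hI hu)).continuousAt.continuousWithinAt
  obtain ⟨θ, hθ⟩ := (isCompact_Icc.image_of_continuousOn hFc).exists_isLeast
    ((nonempty_Icc.2 hab).image _)
  refine ⟨θ, hθ, ?_, ?_⟩
  · obtain ⟨u, -, rfl⟩ := hθ.1
    exact h1.F_pos u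
  obtain ⟨f, hf, hfs, hfF, hfU⟩ := h1.exists_localized_F hab hI
  have hfsC : HasCompactSupport fun x => (f x : ℂ) := hfs.comp_left Complex.ofReal_zero
  obtain ⟨Cf, hCf0, hCf⟩ := exists_norm_funCalc_sub_le (E := L2)
    (hfsC.toSchwartzMap (Complex.ofRealCLM.contDiff.comp hf)) (f := f) fun x => rfl
  have hVs : IsSelfAdjoint V := isSelfAdjoint_mulOp_ofReal U
  -- `K` bounds from below the compact errors: the remainder `R α` of the commutator, and the one
  -- made in replacing `f(U)` by `f(H)`.
  obtain ⟨K, hK, hKZ⟩ := exists_isCompactOperator_forall_le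
    (Z := fun α => R α - (funCalc f (H U α) - funCalc f V)) (c := c + Cf * c)
    (fun α hα => (hRs α hα).sub ((isSelfAdjoint_funCalc f _).sub (isSelfAdjoint_funCalc f _)))
    (fun α hα => IsCompactOperator.sub (hRc α hα)
      (isCompactOperator_funCalc_sub (hHs α hα) hVs (hHc α hα) hf.continuous))
    (fun α hα => (norm_sub_le _ _).trans (by
      rw [add_div, mul_div_assoc]
      refine add_le_add (hRn α hα) ((hCf _ _ (hHs α hα) hVs).trans ?_)
      gcongr
      exact hHn α hα))
  refine ⟨K, hK, fun α hα g hg _ hgI => ?_⟩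
  have hfV : funCalc f V ≤ V' := by
    rw [hV, funCalc_mulOp h1.smooth.continuous h1.abs_le hf.continuous]
    obtain ⟨C₀, hC₀⟩ := hfs.exists_bound_of_continuous hf.continuous
    refine mulOp_mono (memLp_top_of_norm_le (C := C₀) ?_ fun y => ?_)
      (isMultiplier_U h1 h2).memLp_deriv hfU
    · exact (Complex.continuous_ofReal.comp
        (hf.continuous.comp h1.smooth.continuous)).aestronglyMeasurable
    · rw [Complex.norm_real]
      exact hC₀ _
  have e1 : funCalc f (H U α) + K ≤ V' + R α := by
    calc funCalc f (H U α) + K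
        ≤ funCalc f (H U α) + (R α - (funCalc f (H U α) - funCalc f V)) := by
          gcongr
          exact hKZ α hα
      _ = funCalc f V + R α := by abel
      _ ≤ V' + R α := by gcongr
  have e2 : Complex.I • (-Complex.I • (V' + R α)) = V' + R α := by
    rw [smul_smul, mul_neg, Complex.I_mul_I, neg_neg, one_smul]
  rw [e2]
  refine le_trans ?_ (conjugate_le_conjugate e1 (isSelfAdjoint_funCalc g (H U α)))
  rw [mul_add, add_mul]
  gcongr
  refine smul_sq_funCalc_le hf.continuous hg.continuous (fun x hx => ?_) _
  have hxI := hgI (subset_tsupport g hx)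
  rw [hfF x hxI]
  exact hθ.2 (mem_image_of_mem _ hxI)
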